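/- Theorem 5.2 (SeLegue). Let $H$ be a Hilbert space and let $\mathcal{M} \subseteq B(H)$ be a von Neumann algebra that is a direct sum of type I factors, i.e. there is a family of mutually orthogonal central projections $z_i$ of $\mathcal M$ with $\sum_i z_i = 1$ (strongly) such that each $z_i\mathcal{M}$ is a type I factor. Let $\mathcal{M}_*$ be its predual, the space of normal ($\sigma$-weakly continuous) linear functionals on $\mathcal M$. Call an element of $\mathcal{M}$ compact if it lies in the norm closed two-sided ideal of $\mathcal{M}$ generated by the minimal projections of $\mathcal{M}$ (for $\mathcal{M} = B(H)$, and more generally if every minimal projection of $\mathcal M$ has finite rank, these are exactly the compact operators in $\mathcal{M}$). Let $\mathcal{S}$ be a dense subsemigroup of $\mathbb{R}_+ = [0,\infty)$ (with or without $0$) such that $t - s \in \mathcal{S}$ whenever $s, t \in \mathcal{S}$ and $s < t$. Let $\phi = \{\phi_s\}_{s\in\mathcal{S}}$ be a semigroup of normal positive linear maps on $\mathcal{M}$, i.e. $\phi_{s+t} = \phi_s\circ\phi_t$ for all $s,t\in\mathcal{S}$, and $\phi_0 = \mathrm{id}_{\mathcal{M}}$ if $0 \in \mathcal{S}$. (Neither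 contractivity nor continuity in $s$ is assumed.) Assume that for all compact $x \in \mathcal{M}$ and all $\rho\in\mathcal{M}_*$, $$\lim_{\mathcal{S}\ni s\to 0}\rho(\phi_s(x)) = \rho(x) \quad\text{and}\quad \lim_{\mathcal{S}\ni s\to 0}\rho(\phi_s(1)) = \rho(1).$$ Then there is a family $\hat\phi = \{\hat\phi_t\}_{t\ge 0}$ of normal positive linear maps on $\mathcal{M}$ with $\hat\phi_0 = \mathrm{id}_{\mathcal{M}}$, $\hat\phi_{s+t} = \hat\phi_s\circ\hat\phi_t$ for all $s,t\ge 0$, and $\hat\phi_s = \phi_s$ for all $s\in\mathcal{S}$, such that $$\lim_{t\to t_0}\rho(\hat\phi_t(a)) = \rho(\hat\phi_{t_0}(a)) \quad\text{for all } a\in\mathcal{M},\ \rho\in\mathcal{M}_*,\ t_0\ge 0.$$ Moreover, if all $\phi_s$ are contractive, then so are all $\hat\phi_t$; if all $\phi_s$ are completely positive, then so are all $\hat\phi_t$; if all $\phi_s$ are unital, then so are all $\hat\phi_t$; and if all $\phi_s$ are (not necessarily unital) $*$-endomorphisms, then so are all $\hat\phi_t$. -/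

import Mathlib

open Filter Topology
open scoped NNReal ComplexOrder

namespace VNSemigroup

section Algebra

variable {H : Type*} [NormedAddCommGroup H] [InnerProductSpace ℂ H] [CompleteSpace H]

/-- A minimal projection of the von Neumann algebra `M`: a nonzero projection `e ∈ M` whose only
subprojections in `M` are `0` and `e`. -/
def IsMinimalProjection (M : VonNeumannAlgebra H) (e : M.toStarSubalgebra) : Prop :=
  IsStarProjection e ∧ e ≠ 0 ∧
    ∀ f : M.toStarSubalgebra, IsStarProjection f → f * e = f → f = 0 ∨ f = e

/-- `z` is a central projection of `M` for which the corner `z M` is a type I factor: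
it is nonzero, the center of `z M` is `ℂ z`, and `z M` contains a minimal projection. -/
structure IsTypeIFactorSummand (M : VonNeumannAlgebra H) (z : M.toStarSubalgebra) : Prop where
  isStarProjection : IsStarProjection z
  central : ∀ x : M.toStarSubalgebra, z * x = x * z
  ne_zero : z ≠ 0
  factor : ∀ x : M.toStarSubalgebra, z * x = x →
    (∀ y : M.toStarSubalgebra, z * y = y → x * y = y * x) → ∃ c : ℂ, x = c • z
  typeI : ∃ e : M.toStarSubalgebra, IsMinimalProjection M e ∧ z * e = e

/-- `M` is a direct sum of type I factors: there is a family of mutually orthogonal central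
projections of `M`, with sum `1` in the strong operator topology, each of which cuts `M` down to a
type I factor. (The factors may be of any dimension and act with any multiplicity, and the family
may have any cardinality.) -/
def IsDirectSumOfTypeIFactors (M : VonNeumannAlgebra H) : Prop :=
  ∃ Z : Set M.toStarSubalgebra,
    (∀ z ∈ Z, IsTypeIFactorSummand M z) ∧
    (∀ z ∈ Z, ∀ w ∈ Z, z ≠ w → z * w = 0) ∧
    ∀ h : H, HasSum (fun z : Z => ((z : M.toStarSubalgebra) : H →L[ℂ] H) h) h

/-- The compact elements of `M`: the norm closed two-sided ideal of `M` generated by its minimal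
projections. For `M = B(H)` these are the compact operators on `H`; for a direct sum of algebras
`B(H_i)`, acting on the direct sum of the Hilbert spaces `H_i` (or, more generally, when each
summand acts with finite multiplicity), these are the compact operators that belong to `M`. -/
def compactElements (M : VonNeumannAlgebra H) : Set M.toStarSubalgebra :=
  closure (Submodule.span ℂ {x : M.toStarSubalgebra |
    ∃ a e b : M.toStarSubalgebra, IsMinimalProjection M e ∧ x = a * e * b} :
      Set M.toStarSubalgebra)

/-- `ρ` belongs to the predual of `M`, i.e. it is a normal (σ-weakly continuous) linear functional:
`ρ(x) = ∑ ⟨x h_n, g_n⟩` for square summable sequences `h`, `g` of vectors of `H`. -/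
def MemPredual (M : VonNeumannAlgebra H) (ρ : M.toStarSubalgebra →ₗ[ℂ] ℂ) : Prop :=
  ∃ h g : ℕ → H, Summable (fun n => ‖h n‖ ^ 2) ∧ Summable (fun n => ‖g n‖ ^ 2) ∧
    ∀ x : M.toStarSubalgebra, HasSum (fun n => inner ℂ (g n) ((x : H →L[ℂ] H) (h n))) (ρ x)

/-- A linear map of `M` is normal if it is continuous for the weak* topology of `M`, i.e. if it
pulls elements of the predual back to elements of the predual. -/
def IsNormalMap (M : VonNeumannAlgebra H) (φ : M.toStarSubalgebra →ₗ[ℂ] M.toStarSubalgebra) :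
    Prop :=
  ∀ ρ : M.toStarSubalgebra →ₗ[ℂ] ℂ, MemPredual M ρ → MemPredual M (ρ ∘ₗ φ)

/-- A positive linear map: it sends positive operators to positive operators. -/
def IsPositiveMap (M : VonNeumannAlgebra H) (φ : M.toStarSubalgebra →ₗ[ℂ] M.toStarSubalgebra) :
    Prop :=
  ∀ x : M.toStarSubalgebra, (x : H →L[ℂ] H).IsPositive → (φ x : H →L[ℂ] H).IsPositive

/-- A matrix over `M` is positive if it is positive as an operator on the direct sum of `n` copies
of `H`. -/
def IsPositiveMatrix (M : VonNeumannAlgebra H) {n : ℕ}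
    (a : Matrix (Fin n) (Fin n) M.toStarSubalgebra) : Prop :=
  ∀ h : Fin n → H, 0 ≤ ∑ i, ∑ j, inner ℂ (h i) ((a i j : H →L[ℂ] H) (h j))

/-- A completely positive linear map: all its matrix amplifications are positive. -/
def IsCompletelyPositive (M : VonNeumannAlgebra H)
    (φ : M.toStarSubalgebra →ₗ[ℂ] M.toStarSubalgebra) : Prop :=
  ∀ (n : ℕ) (a : Matrix (Fin n) (Fin n) M.toStarSubalgebra),
    IsPositiveMatrix M a → IsPositiveMatrix M (a.map φ)

/-- A contractive linear map. -/
def IsContractive (M : VonNeumannAlgebra H) (φ : M.toStarSubalgebra →ₗ[ℂ] M.toStarSubalgebra) :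
    Prop :=
  ∀ x : M.toStarSubalgebra, ‖φ x‖ ≤ ‖x‖

/-- A *-endomorphism (not necessarily unital). -/
def IsStarEndomorphism (M : VonNeumannAlgebra H)
    (φ : M.toStarSubalgebra →ₗ[ℂ] M.toStarSubalgebra) : Prop :=
  (∀ x y : M.toStarSubalgebra, φ (x * y) = φ x * φ y) ∧
    ∀ x : M.toStarSubalgebra, φ (star x) = star (φ x)

/-- A one-parameter semigroup of linear maps of `M`, indexed by an additive subsemigroup `S` of
`ℝ₊` (which may or may not contain `0`). -/
structure IsSemigroupOver (M : VonNeumannAlgebra H) (S : AddSubsemigroup ℝ≥0)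
    (φ : S → (M.toStarSubalgebra →ₗ[ℂ] M.toStarSubalgebra)) : Prop where
  map_zero : ∀ s : S, (s : ℝ≥0) = 0 → φ s = LinearMap.id
  map_add : ∀ s t : S, φ (s + t) = φ s ∘ₗ φ t

end Algebra

end VNSemigroup

/-!
The argument takes place on the predual `M_*`. It is a norm closed subspace of the dual of `M`
(`isClosed_predual`) and `M` is its Banach space dual (`exists_forall_predual_eq`), so normal maps
of `M` are the adjoints of bounded operators on `M_*`, and it suffices to extend the semigroup of
preadjoints `ρ ↦ ρ ∘ φ s` to a strongly continuous semigroup over `ℝ≥0`.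

The hypothesis gives only weak convergence `ρ ∘ φ s → ρ` as `s → 0`, tested on compact elements
and on `1`. It becomes norm convergence by a Kadec–Klee property special to atomic algebras
(`tendsto_vectorFunctional_of_compact`). A vector state is nearly carried by a finite sum `p` of
orthogonal minimal projections (`exists_finset_minimal_approx`). Convergence at `1 - p` and the
Cauchy–Schwarz inequality show that the functionals `ρ ∘ φ s`, which are positive, are also nearly
carried by `p`, uniformly for small `s`; and since `e M f` is at most one-dimensional for minimal
projections `e` and `f`, pointwise convergence on `p M p` is norm convergence. The uniform
boundedness principle, applied to `φ s 1`, bounds the maps near `0`, and the convergence passes from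
vector states to the whole predual.

A semigroup of operators over `S` which is strongly continuous at `0` has orbits that are uniformly
continuous on bounded sets, because `S` is closed under positive differences; hence it extends
(`exists_strongly_continuous_extension`). Positivity, contractivity, complete positivity and
unitality are closed conditions in the weak* topology, so they pass from `S` to `ℝ≥0`.
Multiplicativity is not; it is obtained from the semigroup law and the norm continuity of the
preadjoint orbits (`map_mul_of_dense`).
-/

namespace VNSemigroup

/-! ### The predual of a von Neumann algebra -/

section Predual

variable {H : Type*} [NormedAddCommGroup H] [InnerProductSpace ℂ H] [CompleteSpace H]
variable (M : VonNeumannAlgebra H)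

/-- The vector functional `x ↦ ⟪g, x h⟫` on `M`. -/
noncomputable def vectorFunctional (h g : H) : StrongDual ℂ M.toStarSubalgebra :=
  LinearMap.mkContinuous
    { toFun := fun x => inner ℂ g ((x : H →L[ℂ] H) h)
      map_add' := fun x y => by simp
      map_smul' := fun c x => by simp }
    (‖h‖ * ‖g‖) fun x => by
      calc ‖inner ℂ g ((x : H →L[ℂ] H) h)‖ ≤ ‖g‖ * (‖(x : H →L[ℂ] H)‖ * ‖h‖) :=
            (norm_inner_le_norm _ _).trans (by gcongr; exact ContinuousLinearMap.le_opNorm _ _)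
        _ = ‖h‖ * ‖g‖ * ‖x‖ := by rw [← show ‖x‖ = ‖(x : H →L[ℂ] H)‖ from rfl]; ring

@[simp]
theorem vectorFunctional_apply (h g : H) (x : M.toStarSubalgebra) :
    vectorFunctional M h g x = inner ℂ g ((x : H →L[ℂ] H) h) := rfl

theorem norm_vectorFunctional_le (h g : H) : ‖vectorFunctional M h g‖ ≤ ‖h‖ * ‖g‖ :=
  LinearMap.mkContinuous_norm_le _ (by positivity) _

theorem vectorFunctional_add_left (h k g : H) :
    vectorFunctional M (h + k) g = vectorFunctional M h g + vectorFunctional M k g := by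
  ext x; simp

theorem vectorFunctional_smul_left (c : ℂ) (h g : H) :
    vectorFunctional M (c • h) g = c • vectorFunctional M h g := by
  ext x; simp

theorem vectorFunctional_add_right (h g k : H) :
    vectorFunctional M h (g + k) = vectorFunctional M h g + vectorFunctional M h k := by
  ext x; simp

theorem vectorFunctional_smul_right (c : ℂ) (h g : H) :
    vectorFunctional M h (c • g) = (starRingEnd ℂ) c • vectorFunctional M h g := by
  ext x; simp [mul_comm]

/-- A polarization identity for vector functionals. -/
theorem vectorFunctional_polarization (h g : H) :
    vectorFunctional M h g = (4⁻¹ : ℂ) • (vectorFunctional M (h + g) (h + g)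
      - vectorFunctional M (h - g) (h - g)
      + Complex.I • vectorFunctional M (h + Complex.I • g) (h + Complex.I • g)
      - Complex.I • vectorFunctional M (h - Complex.I • g) (h - Complex.I • g)) := by
  simp only [sub_eq_add_neg, ← neg_smul, ← neg_one_smul ℂ g, vectorFunctional_add_left,
    vectorFunctional_smul_left, vectorFunctional_add_right, vectorFunctional_smul_right]
  simp only [smul_add, smul_smul, smul_neg]
  ext x
  simp only [vectorFunctional_apply, add_apply, smul_apply, neg_apply, smul_eq_mul, map_neg,
    map_one, Complex.conj_I]
  ring_nf
  simp only [Complex.I_sq]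
  ring

/-- `MemPredual` may be checked with square summable families indexed by any countably infinite
type. -/
theorem memPredual_of_denumerable {ι : Type*} [Denumerable ι]
    {ρ : M.toStarSubalgebra →ₗ[ℂ] ℂ} {h g : ι → H} (hh : Summable fun i => ‖h i‖ ^ 2)
    (hg : Summable fun i => ‖g i‖ ^ 2)
    (hρ : ∀ x, HasSum (fun i => vectorFunctional M (h i) (g i) x) (ρ x)) : MemPredual M ρ :=
  let E := (Denumerable.eqv ι).symm
  ⟨h ∘ E, g ∘ E, (E.summable_iff (f := fun i => ‖h i‖ ^ 2)).2 hh,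
    (E.summable_iff (f := fun i => ‖g i‖ ^ 2)).2 hg,
    fun x => (E.hasSum_iff (f := fun i => vectorFunctional M (h i) (g i) x)).2 (hρ x)⟩

/-- The predual of `M`, as a subspace of the Banach space dual of `M`. -/
noncomputable def predual : Submodule ℂ (StrongDual ℂ M.toStarSubalgebra) where
  carrier := {ρ | MemPredual M (ρ : M.toStarSubalgebra →ₗ[ℂ] ℂ)}
  zero_mem' := ⟨0, 0, by simp [summable_zero], by simp [summable_zero], fun x => by
    simp [hasSum_zero]⟩
  add_mem' := by
    rintro ρ σ ⟨h, g, hh, hg, hρ⟩ ⟨h', g', hh', hg', hσ⟩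
    refine memPredual_of_denumerable M (ι := ℕ ⊕ ℕ) (h := Sum.elim h h') (g := Sum.elim g g')
      (Summable.sum _ (by simpa [Function.comp_def] using hh)
        (by simpa [Function.comp_def] using hh'))
      (Summable.sum _ (by simpa [Function.comp_def] using hg)
        (by simpa [Function.comp_def] using hg')) fun x => ?_
    exact HasSum.sum (f := fun i => vectorFunctional M (Sum.elim h h' i) (Sum.elim g g' i) x)
      (hρ x) (hσ x)
  smul_mem' := by
    rintro c ρ ⟨h, g, hh, hg, hρ⟩
    refine ⟨fun n => c • h n, g, ?_, hg, fun x => ?_⟩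
    · simpa only [norm_smul, mul_pow] using hh.mul_left _
    · simpa [inner_smul_right] using (hρ x).mul_left c

variable {M}

theorem mem_predual_iff {ρ : StrongDual ℂ M.toStarSubalgebra} :
    ρ ∈ predual M ↔ MemPredual M (ρ : M.toStarSubalgebra →ₗ[ℂ] ℂ) := Iff.rfl

theorem vectorFunctional_mem_predual (h g : H) : vectorFunctional M h g ∈ predual M := by
  refine ⟨Pi.single 0 h, Pi.single 0 g, ?_, ?_, fun x => ?_⟩
  · exact summable_of_ne_finset_zero (s := {0}) fun n hn => by
      simp [Pi.single_eq_of_ne (M := fun _ => H) (by simpa using hn : n ≠ 0)]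
  · exact summable_of_ne_finset_zero (s := {0}) fun n hn => by
      simp [Pi.single_eq_of_ne (M := fun _ => H) (by simpa using hn : n ≠ 0)]
  · convert hasSum_single (f := fun n => inner ℂ ((Pi.single 0 g : ℕ → H) n)
      ((x : H →L[ℂ] H) ((Pi.single 0 h : ℕ → H) n))) 0 fun n hn => by simp [hn] using 1
    simp

theorem summable_norm_vectorFunctional {ι : Type*} {h g : ι → H}
    (hh : Summable fun i => ‖h i‖ ^ 2) (hg : Summable fun i => ‖g i‖ ^ 2) :
    Summable fun i => ‖vectorFunctional M (h i) (g i)‖ :=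
  .of_nonneg_of_le (fun _ => norm_nonneg _)
    (fun i => (norm_vectorFunctional_le M _ _).trans
      (by nlinarith [sq_nonneg (‖h i‖ - ‖g i‖), norm_nonneg (h i)] :
        _ ≤ ‖h i‖ ^ 2 + ‖g i‖ ^ 2)) (hh.add hg)

/-- The series representing an element of the predual converges in norm. -/
theorem hasSum_vectorFunctional {ι : Type*} {h g : ι → H}
    (hh : Summable fun i => ‖h i‖ ^ 2) (hg : Summable fun i => ‖g i‖ ^ 2)
    {ρ : StrongDual ℂ M.toStarSubalgebra}
    (hρ : ∀ x, HasSum (fun i => vectorFunctional M (h i) (g i) x) (ρ x)) :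
    HasSum (fun i => vectorFunctional M (h i) (g i)) ρ := by
  have hs : Summable fun i => vectorFunctional M (h i) (g i) :=
    (summable_norm_vectorFunctional hh hg).of_norm
  have : ρ = ∑' i, vectorFunctional M (h i) (g i) := by
    refine ContinuousLinearMap.ext fun x => (hρ x).unique ?_
    exact hs.hasSum.mapL (ContinuousLinearMap.apply ℂ ℂ x)
  rw [this]
  exact hs.hasSum

/-- Every element of the predual, a priori only a linear functional, is norm continuous. -/
theorem MemPredual.exists_strongDual {ρ : M.toStarSubalgebra →ₗ[ℂ] ℂ} (hρ : MemPredual M ρ) :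
    ∃ σ ∈ predual M, (σ : M.toStarSubalgebra →ₗ[ℂ] ℂ) = ρ := by
  have hρ' := hρ
  obtain ⟨h, g, hh, hg, hsum⟩ := hρ
  have hs : Summable fun i => vectorFunctional M (h i) (g i) :=
    (summable_norm_vectorFunctional hh hg).of_norm
  have key : ((∑' n, vectorFunctional M (h n) (g n) : StrongDual ℂ M.toStarSubalgebra) :
      M.toStarSubalgebra →ₗ[ℂ] ℂ) = ρ := by
    refine LinearMap.ext fun x => HasSum.unique ?_ (hsum x)
    exact hs.hasSum.mapL (ContinuousLinearMap.apply ℂ ℂ x)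
  exact ⟨_, by rw [mem_predual_iff, key]; exact hρ', key⟩

/-- A property of functionals that is closed under linear combinations and norm limits holds on
the whole predual once it holds for the vector states `x ↦ ⟪h, x h⟫`. -/
theorem predual_le_of_isClosed (X : Submodule ℂ (StrongDual ℂ M.toStarSubalgebra))
    (hX : IsClosed (X : Set (StrongDual ℂ M.toStarSubalgebra)))
    (hv : ∀ h, vectorFunctional M h h ∈ X) : predual M ≤ X := by
  rintro ρ ⟨h, g, hh, hg, hρ⟩
  have hv' (h g) : vectorFunctional M h g ∈ X := by
    rw [vectorFunctional_polarization]
    exact X.smul_mem _ (X.sub_mem (X.add_mem (X.sub_mem (hv _) (hv _)) (X.smul_mem _ (hv _)))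
      (X.smul_mem _ (hv _)))
  exact hX.mem_of_tendsto (hasSum_vectorFunctional hh hg hρ)
    (.of_forall fun s => X.sum_mem fun i _ => hv' _ _)

/-- The predual separates the points of `M`. -/
theorem eq_of_predual_eq {x y : M.toStarSubalgebra} (h : ∀ ρ ∈ predual M, ρ x = ρ y) : x = y := by
  refine Subtype.ext (ContinuousLinearMap.ext fun k => ext_inner_left ℂ fun g => ?_)
  exact h _ (vectorFunctional_mem_predual k g)

/-- `M` is the dual of its predual: every bounded functional on the dual of `M` agrees on the
predual with evaluation at some element of `M`. -/
theorem exists_forall_predual_eq (F : StrongDual ℂ (StrongDual ℂ M.toStarSubalgebra)) :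
    ∃ a : M.toStarSubalgebra, ∀ ρ ∈ predual M, F ρ = ρ a := by
  let B₀ : H →ₗ⋆[ℂ] H →ₗ[ℂ] ℂ := LinearMap.mk₂'ₛₗ (starRingEnd ℂ) (RingHom.id ℂ)
    (fun v w => F (vectorFunctional M w v))
    (fun v v' w => by rw [vectorFunctional_add_right, map_add])
    (fun c v w => by rw [vectorFunctional_smul_right, map_smul])
    (fun v w w' => by rw [vectorFunctional_add_left, map_add])
    (fun c v w => by rw [vectorFunctional_smul_left, map_smul]; rfl)
  let B : H →L⋆[ℂ] H →L[ℂ] ℂ := B₀.mkContinuous₂ ‖F‖ fun v w => by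
    calc ‖F (vectorFunctional M w v)‖ ≤ ‖F‖ * (‖w‖ * ‖v‖) :=
          (F.le_opNorm _).trans (by gcongr; exact norm_vectorFunctional_le M _ _)
      _ = ‖F‖ * ‖v‖ * ‖w‖ := by ring
  let A : H →L[ℂ] H :=
    ContinuousLinearMap.adjoint (InnerProductSpace.continuousLinearMapOfBilin B)
  have hA (v w : H) : inner ℂ v (A w) = F (vectorFunctional M w v) := by
    rw [ContinuousLinearMap.adjoint_inner_right,
      InnerProductSpace.continuousLinearMapOfBilin_apply]
    rfl
  have hAM : A ∈ M := by
    rw [← M.commutant_commutant, VonNeumannAlgebra.mem_commutant_iff]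
    intro y hy
    rw [VonNeumannAlgebra.mem_commutant_iff] at hy
    refine ContinuousLinearMap.ext fun w => ext_inner_left ℂ fun v => ?_
    have : vectorFunctional M w (ContinuousLinearMap.adjoint y v) =
        vectorFunctional M (y w) v := by
      ext x
      have : (x : H →L[ℂ] H) (y w) = y ((x : H →L[ℂ] H) w) := congr($(hy x x.2) w)
      simp [ContinuousLinearMap.adjoint_inner_left, this]
    change inner ℂ v (y (A w)) = inner ℂ v (A (y w))
    rw [hA, ← this, ← hA, ContinuousLinearMap.adjoint_inner_left]
  refine ⟨⟨A, hAM⟩, ?_⟩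
  rintro ρ ⟨h, g, hh, hg, hρ⟩
  refine ((hasSum_vectorFunctional hh hg hρ).mapL F).unique ?_
  have : (fun n => F (vectorFunctional M (h n) (g n))) = fun n => inner ℂ (g n) (A (h n)) :=
    funext fun n => (hA _ _).symm
  rw [this]
  exact hρ ⟨A, hAM⟩

variable (M) in
/-- The functionals `x ↦ ∑ ⟪g n, x (h n)⟫` with `∑ ‖h n‖² ≤ 1` and `∑ ‖g n‖² ≤ 1`. They form a
norm dense subset of the closed unit ball of the predual. -/
def predualUnitBall : Set (StrongDual ℂ M.toStarSubalgebra) :=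
  {ρ | ∃ h g : ℕ → H, Summable (fun n => ‖h n‖ ^ 2) ∧ Summable (fun n => ‖g n‖ ^ 2) ∧
    ∑' n, ‖h n‖ ^ 2 ≤ 1 ∧ ∑' n, ‖g n‖ ^ 2 ≤ 1 ∧
    ∀ x, HasSum (fun n => vectorFunctional M (h n) (g n) x) (ρ x)}

theorem convex_predualUnitBall : Convex ℝ (predualUnitBall M) := by
  rintro ρ ⟨h, g, hh, hg, hh1, hg1, hρ⟩ σ ⟨h', g', hh', hg', hh1', hg1', hσ⟩ a b ha hb hab
  let E := (Denumerable.eqv (ℕ ⊕ ℕ)).symm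
  have sq {c : ℝ} (hc : 0 ≤ c) (v : H) : ‖((√c : ℝ) : ℂ) • v‖ ^ 2 = c * ‖v‖ ^ 2 := by
    rw [norm_smul, mul_pow, Complex.norm_real, Real.norm_of_nonneg (Real.sqrt_nonneg _),
      Real.sq_sqrt hc]
  have aux {u u' : ℕ → H} (hu : Summable fun n => ‖u n‖ ^ 2) (hu' : Summable fun n => ‖u' n‖ ^ 2) :
      HasSum (fun i => ‖(Sum.elim (fun n => ((√a : ℝ) : ℂ) • u n)
        (fun n => ((√b : ℝ) : ℂ) • u' n) : ℕ ⊕ ℕ → H) i‖ ^ 2)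
        (a * ∑' n, ‖u n‖ ^ 2 + b * ∑' n, ‖u' n‖ ^ 2) :=
    HasSum.sum (by simpa only [sq ha, Function.comp_def, Sum.elim_inl] using hu.hasSum.mul_left a)
      (by simpa only [sq hb, Function.comp_def, Sum.elim_inr] using hu'.hasSum.mul_left b)
  have H1 := aux hh hh'
  have H2 := aux hg hg'
  refine ⟨_ ∘ E, _ ∘ E, (E.summable_iff (f := fun i => ‖_‖ ^ 2)).2 H1.summable,
    (E.summable_iff (f := fun i => ‖_‖ ^ 2)).2 H2.summable, ?_, ?_, fun x => ?_⟩
  · refine (((E.hasSum_iff (f := fun i => ‖_‖ ^ 2)).2 H1).tsum_eq).trans_le ?_; nlinarith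
  · refine (((E.hasSum_iff (f := fun i => ‖_‖ ^ 2)).2 H2).tsum_eq).trans_le ?_; nlinarith
  · refine (E.hasSum_iff (f := fun i => vectorFunctional M _ _ x)).2 ?_
    have sq' {c : ℝ} (hc : 0 ≤ c) : ((√c : ℝ) : ℂ) * ((√c : ℝ) : ℂ) = c := by
      rw [← Complex.ofReal_mul, Real.mul_self_sqrt hc]
    refine HasSum.sum ?_ ?_
    · refine ((hρ x).mul_left (a : ℂ)).congr_fun fun n => ?_
      simp only [Function.comp_def, Sum.elim_inl, vectorFunctional_apply, map_smul,
        inner_smul_left, inner_smul_right, ← mul_assoc, Complex.conj_ofReal, sq' ha]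
    · refine ((hσ x).mul_left (b : ℂ)).congr_fun fun n => ?_
      simp only [Function.comp_def, Sum.elim_inr, vectorFunctional_apply, map_smul,
        inner_smul_left, inner_smul_right, ← mul_assoc, Complex.conj_ofReal, sq' hb]

theorem vectorFunctional_mem_predualUnitBall {h g : H} (hh : ‖h‖ ≤ 1) (hg : ‖g‖ ≤ 1) :
    vectorFunctional M h g ∈ predualUnitBall M := by
  have key (v : H) : HasSum (fun n => ‖(Pi.single 0 v : ℕ → H) n‖ ^ 2) (‖v‖ ^ 2) := by
    convert hasSum_single (f := fun n => ‖(Pi.single 0 v : ℕ → H) n‖ ^ 2) 0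
      fun n hn => by simp [hn] using 1
    simp
  refine ⟨Pi.single 0 h, Pi.single 0 g, (key h).summable, (key g).summable, ?_, ?_, fun x => ?_⟩
  · rw [(key h).tsum_eq]; exact pow_le_one₀ (norm_nonneg _) hh
  · rw [(key g).tsum_eq]; exact pow_le_one₀ (norm_nonneg _) hg
  · convert hasSum_single (f := fun n => vectorFunctional M ((Pi.single 0 h : ℕ → H) n)
      ((Pi.single 0 g : ℕ → H) n) x) 0 fun n hn => by simp [hn] using 1
    simp

/-- Functionals of norm at most one in the predual are limits of functionals represented by
families in the unit ball of `ℓ²(H)`: otherwise a functional separating the two is, on the predual,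
the evaluation at an element of `M` whose norm is too small. -/
theorem mem_closure_predualUnitBall {ρ : StrongDual ℂ M.toStarSubalgebra} (hρ : ρ ∈ predual M)
    (h1 : ‖ρ‖ ≤ 1) : ρ ∈ closure (predualUnitBall M) := by
  by_contra hn
  obtain ⟨F, u, hF, hu⟩ := RCLike.geometric_hahn_banach_closed_point (𝕜 := ℂ)
    convex_predualUnitBall.closure isClosed_closure hn
  obtain ⟨a, ha⟩ := exists_forall_predual_eq F
  have hb {h g : H} (hh : ‖h‖ ≤ 1) (hg : ‖g‖ ≤ 1) :
      RCLike.re (inner ℂ g ((a : H →L[ℂ] H) h)) < u := by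
    have := hF _ (subset_closure (vectorFunctional_mem_predualUnitBall (M := M) hh hg))
    rwa [ha _ (vectorFunctional_mem_predual _ _)] at this
  have hu0 : 0 < u := by simpa using hb (h := 0) (g := 0) (by simp) (by simp)
  have hnorm : ‖a‖ ≤ u := by
    refine ContinuousLinearMap.opNorm_le_of_unit_norm (𝕜 := ℂ) hu0.le fun h hh => ?_
    -- pair `a h` with the unit vector in its own direction
    change ‖(a : H →L[ℂ] H) h‖ ≤ u
    rcases eq_or_ne ((a : H →L[ℂ] H) h) 0 with h0 | h0
    · rw [h0, norm_zero]; exact hu0.le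
    have := hb (h := h) (g := ((‖(a : H →L[ℂ] H) h‖⁻¹ : ℝ) : ℂ) • (a : H →L[ℂ] H) h) hh.le
      (by rw [norm_smul, Complex.norm_real, norm_inv, norm_norm,
            inv_mul_cancel₀ (norm_ne_zero_iff.2 h0)])
    rw [inner_smul_left, inner_self_eq_norm_sq_to_K, Complex.conj_ofReal] at this
    have h3 : ‖(a : H →L[ℂ] H) h‖⁻¹ * ‖(a : H →L[ℂ] H) h‖ ^ 2 = ‖(a : H →L[ℂ] H) h‖ := by
      have := norm_ne_zero_iff.2 h0
      field_simp
    have h4 : ((‖(a : H →L[ℂ] H) h‖⁻¹ : ℝ) : ℂ) * ((‖(a : H →L[ℂ] H) h‖ : ℝ) : ℂ) ^ 2 =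
        ((‖(a : H →L[ℂ] H) h‖ : ℝ) : ℂ) := by exact_mod_cast h3
    exact (congrArg Complex.re h4).symm.trans_lt this |>.le
  rw [ha _ hρ] at hu
  have : RCLike.re (ρ a) ≤ u := calc
    RCLike.re (ρ a) ≤ ‖ρ a‖ := RCLike.re_le_norm _
    _ ≤ ‖ρ‖ * ‖a‖ := ρ.le_opNorm _
    _ ≤ 1 * u := by gcongr
    _ = u := one_mul u
  exact absurd hu this.not_gt

theorem predualUnitBall_subset : predualUnitBall M ⊆ predual M :=
  fun _ ⟨h, g, hh, hg, _, _, hρ⟩ => ⟨h, g, hh, hg, hρ⟩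

/-- The approximation step behind the completeness of the predual: a limit `σ` of predual elements
is halved in norm by subtracting a multiple of an element represented in the unit ball. -/
theorem exists_predualUnitBall_approx {σ : StrongDual ℂ M.toStarSubalgebra}
    (hσ : σ ∈ closure (predual M : Set (StrongDual ℂ M.toStarSubalgebra))) {r : ℝ} (hr : 0 < r)
    (h : ‖σ‖ ≤ r) :
    ∃ b ∈ predualUnitBall M, ‖σ - ((2 * r : ℝ) : ℂ) • b‖ ≤ r / 2 := by
  have hc : ((2 * r : ℝ) : ℂ) ≠ 0 := Complex.ofReal_ne_zero.2 (by positivity)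
  have hcn : ‖((2 * r : ℝ) : ℂ)‖ = 2 * r := by
    rw [Complex.norm_real, Real.norm_of_nonneg (by positivity)]
  obtain ⟨τ, hτ, hd⟩ := Metric.mem_closure_iff.1 hσ (r / 4) (by positivity)
  rw [dist_eq_norm] at hd
  have hτn : ‖τ‖ ≤ 2 * r := by
    have := norm_sub_norm_le τ σ
    rw [norm_sub_rev] at this
    linarith
  obtain ⟨b, hb, hd'⟩ := Metric.mem_closure_iff.1
    (mem_closure_predualUnitBall ((predual M).smul_mem ((2 * r : ℝ) : ℂ)⁻¹ hτ) (by
      rw [norm_smul, norm_inv, hcn]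
      exact inv_mul_le_one_of_le₀ hτn (by positivity))) (1 / 8) (by norm_num)
  refine ⟨b, hb, ?_⟩
  have h2 : ‖τ - ((2 * r : ℝ) : ℂ) • b‖ ≤ 2 * r * (1 / 8) := by
    calc ‖τ - ((2 * r : ℝ) : ℂ) • b‖
        = ‖((2 * r : ℝ) : ℂ) • (((2 * r : ℝ) : ℂ)⁻¹ • τ - b)‖ := by
          rw [smul_sub, smul_inv_smul₀ hc]
      _ ≤ 2 * r * (1 / 8) := by
          rw [norm_smul, hcn, ← dist_eq_norm]
          gcongr
  calc ‖σ - ((2 * r : ℝ) : ℂ) • b‖ ≤ ‖σ - τ‖ + ‖τ - ((2 * r : ℝ) : ℂ) • b‖ :=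
        norm_sub_le_norm_sub_add_norm_sub _ _ _
    _ ≤ r / 2 := by linarith

theorem summable_prod_mul {r : ℕ → ℝ} (hr : ∀ n, 0 ≤ r n) (hrs : Summable r) {c : ℕ → ℕ → ℝ}
    (hc : ∀ n k, 0 ≤ c n k) (hcs : ∀ n, Summable (c n)) (hc1 : ∀ n, ∑' k, c n k ≤ 1) :
    Summable fun p : ℕ × ℕ => r p.1 * c p.1 p.2 := by
  have h0 : 0 ≤ fun p : ℕ × ℕ => r p.1 * c p.1 p.2 := fun p => mul_nonneg (hr _) (hc _ _)
  have h1 (n : ℕ) : Summable fun k => r n * c n k := (hcs n).mul_left (r n)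
  refine (summable_prod_of_nonneg h0).2 ⟨h1, ?_⟩
  refine hrs.of_nonneg_of_le (fun n => tsum_nonneg fun k => h0 (n, k)) fun n => ?_
  simp only [tsum_mul_left]
  exact mul_le_of_le_one_right (hr n) (hc1 n)

/-- An absolutely convergent combination of functionals represented in the unit ball of `ℓ²(H)` is
a sum of vector functionals over `ℕ × ℕ`, hence belongs to the predual. -/
theorem mem_predual_of_tendsto_sum {σ : StrongDual ℂ M.toStarSubalgebra} {r : ℕ → ℝ}
    (hr : ∀ n, 0 ≤ r n) (hrs : Summable r) {b : ℕ → StrongDual ℂ M.toStarSubalgebra}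
    (hb : ∀ n, b n ∈ predualUnitBall M)
    (hσ : Tendsto (fun n => ∑ i ∈ Finset.range n, ((r i : ℝ) : ℂ) • b i) atTop (𝓝 σ)) :
    σ ∈ predual M := by
  choose h g hh hg hh1 hg1 hbs using hb
  have sq (n : ℕ) (v : H) : ‖((√(r n) : ℝ) : ℂ) • v‖ ^ 2 = r n * ‖v‖ ^ 2 := by
    rw [norm_smul, mul_pow, Complex.norm_real, Real.norm_of_nonneg (Real.sqrt_nonneg _),
      Real.sq_sqrt (hr n)]
  have Hh : Summable fun p : ℕ × ℕ => ‖((√(r p.1) : ℝ) : ℂ) • h p.1 p.2‖ ^ 2 :=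
    (summable_prod_mul hr hrs (c := fun n k => ‖h n k‖ ^ 2) (fun _ _ => sq_nonneg _) hh
      hh1).congr fun p => (sq _ _).symm
  have Hg : Summable fun p : ℕ × ℕ => ‖((√(r p.1) : ℝ) : ℂ) • g p.1 p.2‖ ^ 2 :=
    (summable_prod_mul hr hrs (c := fun n k => ‖g n k‖ ^ 2) (fun _ _ => sq_nonneg _) hg
      hg1).congr fun p => (sq _ _).symm
  let f : ℕ × ℕ → StrongDual ℂ M.toStarSubalgebra := fun p => vectorFunctional M
    (((√(r p.1) : ℝ) : ℂ) • h p.1 p.2) (((√(r p.1) : ℝ) : ℂ) • g p.1 p.2)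
  have hf : Summable f := .of_norm (summable_norm_vectorFunctional (M := M) Hh Hg)
  have hfib (n : ℕ) : HasSum (fun k => f (n, k)) (((r n : ℝ) : ℂ) • b n) := by
    refine ((hasSum_vectorFunctional (hh n) (hg n) (hbs n)).const_smul
      ((r n : ℝ) : ℂ)).congr_fun fun k => ?_
    simp only [f]
    rw [vectorFunctional_smul_left, vectorFunctional_smul_right, smul_smul, Complex.conj_ofReal,
      ← Complex.ofReal_mul, Real.mul_self_sqrt (hr n)]
  have hσf : HasSum f σ := by
    rw [tendsto_nhds_unique hσ (hf.hasSum.prod_fiberwise hfib).tendsto_sum_nat]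
    exact hf.hasSum
  exact memPredual_of_denumerable M Hh Hg fun x =>
    hσf.mapL (ContinuousLinearMap.apply ℂ ℂ x)

/-- The predual is norm closed in the dual of `M`: a limit of normal functionals is expanded as a
series `∑ 2 rₙ bₙ` with `rₙ` geometric and `bₙ` represented in the unit ball of `ℓ²(H)`. -/
theorem isClosed_predual :
    IsClosed (predual M : Set (StrongDual ℂ M.toStarSubalgebra)) := by
  refine isClosed_of_closure_subset fun σ hσ => ?_
  let r : ℕ → ℝ := fun n => (‖σ‖ + 1) * (1 / 2) ^ n
  have hr (n) : 0 < r n := by positivity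
  have hrs : Summable r := summable_geometric_two.mul_left _
  have step (n : ℕ) (τ : {τ : StrongDual ℂ M.toStarSubalgebra //
      τ ∈ (predual M).topologicalClosure ∧ ‖τ‖ ≤ r n}) :
      ∃ b ∈ predualUnitBall M, ‖τ.1 - ((2 * r n : ℝ) : ℂ) • b‖ ≤ r (n + 1) := by
    obtain ⟨b, hb, h⟩ := exists_predualUnitBall_approx τ.2.1 (hr n) τ.2.2
    exact ⟨b, hb, h.trans_eq (by simp only [r, pow_succ]; ring)⟩
  choose b hb hbr using step
  -- the remainders of the expansion
  let R : (n : ℕ) → {τ : StrongDual ℂ M.toStarSubalgebra //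
      τ ∈ (predual M).topologicalClosure ∧ ‖τ‖ ≤ r n} := fun n =>
    Nat.rec ⟨σ, hσ, by simp [r]⟩ (fun n τ => ⟨τ.1 - ((2 * r n : ℝ) : ℂ) • b n τ,
      Submodule.sub_mem _ τ.2.1 (Submodule.smul_mem _ _
        ((predual M).le_topologicalClosure (predualUnitBall_subset (hb n τ)))), hbr n τ⟩) n
  have hR (n : ℕ) : (R (n + 1)).1 = (R n).1 - ((2 * r n : ℝ) : ℂ) • b n (R n) := rfl
  have hsum (n : ℕ) :
      ∑ i ∈ Finset.range n, ((2 * r i : ℝ) : ℂ) • b i (R i) = σ - (R n).1 := by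
    induction n with
    | zero => simp [R]
    | succ n ih => rw [Finset.sum_range_succ, ih, hR]; abel
  have hR0 : Tendsto (fun n => (R n).1) atTop (𝓝 0) :=
    squeeze_zero_norm (fun n => (R n).2.2) hrs.tendsto_atTop_zero
  refine mem_predual_of_tendsto_sum (r := fun n => 2 * r n) (fun n => by have := hr n; positivity)
    (hrs.mul_left 2) (fun n => hb n (R n)) ?_
  simp_rw [hsum]
  simpa using hR0.const_sub σ

end Predual

/-! ### Minimal projections in direct sums of type I factors -/

section Atoms

variable {H : Type*} [NormedAddCommGroup H] [InnerProductSpace ℂ H] [CompleteSpace H]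
variable {M : VonNeumannAlgebra H}

/-- The projection `q` onto the closure of a subspace invariant under the commutant of `M` lies
in `M`. Besides being the identity on the subspace, it satisfies `z * q = 0` for every operator `z`
that vanishes there. -/
theorem exists_projection_of_invariant (M : VonNeumannAlgebra H) (K : Submodule ℂ H)
    (hK : ∀ y ∈ M.commutant, ∀ v ∈ K, y v ∈ K) :
    ∃ q : H →L[ℂ] H, q ∈ M ∧ IsStarProjection q ∧ (∀ v ∈ K, q v = v) ∧
      (∀ z : H →L[ℂ] H, (∀ v ∈ K, z v = 0) → z * q = 0) ∧
      q = K.topologicalClosure.starProjection := by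
  have : CompleteSpace K.topologicalClosure := K.isClosed_topologicalClosure.completeSpace_coe
  refine ⟨K.topologicalClosure.starProjection, ?_, isStarProjection_starProjection,
    fun v hv => ?_, fun z hz => ?_, rfl⟩
  · rw [VonNeumannAlgebra.IsStarProjection.mem_iff isStarProjection_starProjection]
    intro y hy
    rw [Submodule.range_starProjection, Module.End.mem_invtSubmodule]
    intro v hv
    have : Set.MapsTo y (closure (K : Set H)) (closure (K : Set H)) :=
      Set.MapsTo.closure (fun v hv => hK y hy v hv) y.continuous
    exact this hv
  · exact Submodule.starProjection_eq_self_iff.2 (K.le_topologicalClosure hv)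
  · ext v
    have hle : K.topologicalClosure ≤ LinearMap.ker (z : H →ₗ[ℂ] H) :=
      K.topologicalClosure_minimal (fun v hv => hz v hv) z.isClosed_ker
    exact hle (Submodule.starProjection_apply_mem _ v)

/-- A self-adjoint element `t` of `e M e`, for a minimal projection `e`, has a definite sign: the
range projection of `t⁺` is a subprojection of `e`, so it is `0`, in which case `t ≤ 0`, or `e`, in
which case `t⁻ e = 0` and `t = e t⁺ e ≥ 0`. -/
theorem IsMinimalProjection.nonpos_or_nonneg {e : M.toStarSubalgebra}
    (he : IsMinimalProjection M e) {t : M.toStarSubalgebra} (ht : IsSelfAdjoint t)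
    (het : e * t = t) : (t : H →L[ℂ] H) ≤ 0 ∨ 0 ≤ (t : H →L[ℂ] H) := by
  obtain ⟨⟨hee, hes⟩, he0, hmin⟩ := he
  have hte : t * e = t := by
    have := congrArg star het
    rwa [star_mul, ht.star_eq, hes.star_eq] at this
  obtain ⟨E, hEM⟩ := e
  obtain ⟨T, hTM⟩ := t
  change T ≤ 0 ∨ 0 ≤ T
  have hEs : IsSelfAdjoint E := congrArg Subtype.val hes
  have hTs : IsSelfAdjoint T := congrArg Subtype.val ht
  have hET : E * T = T := congrArg Subtype.val het
  have hTE : T * E = T := congrArg Subtype.val hte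
  obtain ⟨A, hA⟩ : ∃ A : H →L[ℂ] H, A = T⁺ := ⟨_, rfl⟩
  obtain ⟨B, hB⟩ : ∃ B : H →L[ℂ] H, B = T⁻ := ⟨_, rfl⟩
  have hAB : A - B = T := by rw [hA, hB]; exact CFC.posPart_sub_negPart T hTs
  have hBA : B * A = 0 := by rw [hA, hB]; exact CFC.negPart_mul_posPart T
  have hA0 : 0 ≤ A := by rw [hA]; exact CFC.posPart_nonneg T
  have hAs : IsSelfAdjoint A := .of_nonneg hA0
  have hTA : A * A = T * A := by rw [← hAB, sub_mul, hBA, sub_zero]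
  obtain ⟨q, hqM, hq, hqr, hqz, -⟩ := exists_projection_of_invariant M
    (LinearMap.range ((A * A : H →L[ℂ] H) : H →ₗ[ℂ] H)) (by
      rintro k hk _ ⟨v, rfl⟩
      rw [VonNeumannAlgebra.mem_commutant_iff] at hk
      have hc : Commute A k := by
        rw [hA, CFC.posPart_def]
        exact Commute.cfcₙ_real (show Commute T k from hk _ hTM) _
      exact ⟨k v, congr($((hc.mul_left hc).eq) v)⟩)
  have hqE : E * q = q := by
    have h1 : (1 - E) * (A * A) = 0 := by
      rw [hTA, ← mul_assoc, sub_mul, one_mul, hET, sub_self, zero_mul]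
    have h2 := hqz (1 - E) (by rintro _ ⟨v, rfl⟩; exact congr($h1 v))
    rw [sub_mul, one_mul, sub_eq_zero] at h2
    exact h2.symm
  have hqE' : q * E = q := by
    have := congrArg star hqE
    rwa [star_mul, hq.isSelfAdjoint.star_eq, hEs.star_eq] at this
  rcases hmin ⟨q, hqM⟩ ⟨Subtype.ext hq.isIdempotentElem, Subtype.ext hq.isSelfAdjoint⟩
    (Subtype.ext hqE') with h | h
  · left
    have hq0 : q = 0 := congrArg Subtype.val h
    have hAA : A * A = 0 := by
      ext v
      have := hqr ((A * A) v) ⟨v, rfl⟩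
      rw [hq0] at this
      exact this.symm
    have hA0 : A = 0 :=
      (CStarRing.star_mul_self_eq_zero_iff A).1 (by rw [hAs.star_eq, hAA])
    rw [hA] at hA0
    exact (CFC.posPart_eq_zero_iff T hTs).1 hA0
  · right
    have hqe : q = E := congrArg Subtype.val h
    have h1 : B * E = 0 := by
      rw [← hqe]
      have h2 : B * (A * A) = 0 := by rw [← mul_assoc, hBA, zero_mul]
      exact hqz _ (by rintro _ ⟨v, rfl⟩; exact congr($h2 v))
    have h2 : T = E * A * E := by
      calc T = E * (A - B) * E := by rw [hAB, hET, hTE]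
        _ = E * A * E := by rw [mul_sub, sub_mul, mul_assoc E B, h1, mul_zero, sub_zero]
    rw [h2]
    exact hEs.conjugate_nonneg hA0

/-- If `e` is a minimal projection then every positive `y` in `e M e` equals `‖y‖ e`: for
`0 ≤ μ < ‖y‖` the element `y - μ e` cannot be negative, so `y ≥ μ e`. -/
theorem IsMinimalProjection.eq_smul_of_nonneg {e : M.toStarSubalgebra}
    (he : IsMinimalProjection M e) {y : M.toStarSubalgebra} (hy : 0 ≤ (y : H →L[ℂ] H))
    (hey : e * y = y) : (y : H →L[ℂ] H) = ‖y‖ • (e : H →L[ℂ] H) := by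
  have hee : e * e = e := he.1.isIdempotentElem
  have hes : IsSelfAdjoint e := he.1.isSelfAdjoint
  have hys : IsSelfAdjoint y := Subtype.ext (IsSelfAdjoint.of_nonneg hy)
  have hlower (μ : ℝ) (hμ0 : 0 ≤ μ) (hμ : μ < ‖y‖) :
      μ • (e : H →L[ℂ] H) ≤ (y : H →L[ℂ] H) := by
    have hte : e * (y - (μ : ℂ) • e) = y - (μ : ℂ) • e := by
      rw [mul_sub, mul_smul_comm, hee, hey]
    have hts : IsSelfAdjoint (y - (μ : ℂ) • e) := by
      rw [isSelfAdjoint_iff, star_sub, star_smul, hys.star_eq, hes.star_eq, Complex.star_def,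
        Complex.conj_ofReal]
    rcases he.nonpos_or_nonneg hts hte with h | h
    · exfalso
      have hle : (y : H →L[ℂ] H) ≤ μ • (e : H →L[ℂ] H) := sub_nonpos.1 h
      have h1 := CStarAlgebra.norm_le_norm_of_nonneg_of_le hy hle
      rw [norm_smul, Real.norm_of_nonneg hμ0] at h1
      have h2 : ‖y‖ ≤ μ * ‖e‖ := h1
      nlinarith [IsStarProjection.norm_le e he.1]
    · exact sub_nonneg.1 h
  obtain ⟨E, hEM⟩ := e
  obtain ⟨Y, hYM⟩ := y
  change 0 ≤ Y at hy
  change ∀ μ : ℝ, 0 ≤ μ → μ < ‖Y‖ → μ • E ≤ Y at hlower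
  change Y = ‖Y‖ • E
  have hEE : E * E = E := congrArg Subtype.val hee
  have hEs : IsSelfAdjoint E := congrArg Subtype.val hes
  have hYs : IsSelfAdjoint Y := congrArg Subtype.val hys
  have hEY : E * Y = Y := congrArg Subtype.val hey
  have hYE : Y * E = Y := by
    have := congrArg star hEY
    rwa [star_mul, hYs.star_eq, hEs.star_eq] at this
  have hEn : ‖E‖ ≤ 1 := IsStarProjection.norm_le E ⟨hEE, hEs⟩
  have hupper : Y ≤ ‖Y‖ • E := by
    have h1 : Y ≤ algebraMap ℝ _ ‖Y‖ := IsSelfAdjoint.le_algebraMap_norm_self hYs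
    have h2 := IsSelfAdjoint.conjugate_le_conjugate h1 hEs
    rwa [hEY, hYE, Algebra.algebraMap_eq_smul_one, mul_smul_comm, smul_mul_assoc, mul_one,
      hEE] at h2
  have hsmall (μ : ℝ) (hμ0 : 0 ≤ μ) (hμ : μ < ‖Y‖) : ‖‖Y‖ • E - Y‖ ≤ ‖Y‖ - μ := by
    have h1 : ‖Y‖ • E - Y ≤ (‖Y‖ - μ) • E := by
      rw [sub_smul]
      exact sub_le_sub_left (hlower μ hμ0 hμ) _
    have := CStarAlgebra.norm_le_norm_of_nonneg_of_le (sub_nonneg.2 hupper) h1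
    rw [norm_smul, Real.norm_of_nonneg (sub_nonneg.2 hμ.le)] at this
    nlinarith
  rcases (norm_nonneg Y).eq_or_lt with h0 | h0
  · rw [← h0, zero_smul]
    exact norm_eq_zero.1 h0.symm
  · have : ‖‖Y‖ • E - Y‖ ≤ 0 := by
      refine le_of_forall_pos_le_add fun ε hε => ?_
      have := hsmall (max 0 (‖Y‖ - ε)) (le_max_left _ _) (max_lt h0 (by linarith))
      linarith [le_max_right 0 (‖Y‖ - ε)]
    exact (sub_eq_zero.1 (norm_le_zero_iff.1 this)).symm

/-- If `e` is a minimal projection then `e M e = ℂ e`. -/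
theorem IsMinimalProjection.exists_eq_smul {e : M.toStarSubalgebra}
    (he : IsMinimalProjection M e) (a : M.toStarSubalgebra) : ∃ c : ℂ, e * a * e = c • e := by
  have hes : star e = e := he.1.isSelfAdjoint
  have hee : e * e = e := he.1.isIdempotentElem
  -- the self-adjoint case, by adding a multiple of `e`
  have key (s : M.toStarSubalgebra) (hs : star s = s) : ∃ c : ℂ, e * s * e = c • e := by
    have hs' : IsSelfAdjoint (s : H →L[ℂ] H) := congrArg Subtype.val hs
    have hes' : IsSelfAdjoint (e : H →L[ℂ] H) := congrArg Subtype.val hes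
    have hpos : 0 ≤ (s : H →L[ℂ] H) + algebraMap ℝ _ ‖s‖ := by
      have := IsSelfAdjoint.neg_algebraMap_norm_le_self hs'
      rw [neg_le_iff_add_nonneg] at this
      exact this
    let t : M.toStarSubalgebra := e * (s + (‖s‖ : ℂ) • 1) * e
    have ht : 0 ≤ (t : H →L[ℂ] H) := by
      have := IsSelfAdjoint.conjugate_nonneg hpos hes'
      rwa [Algebra.algebraMap_eq_smul_one, ← Complex.coe_smul] at this
    have h1 := he.eq_smul_of_nonneg ht (by simp only [t]; rw [← mul_assoc, ← mul_assoc, hee])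
    have h2 : t = (‖t‖ : ℂ) • e := Subtype.ext (by rw [h1, ← Complex.coe_smul]; rfl)
    have h3 : t = e * s * e + (‖s‖ : ℂ) • e := by
      simp only [t]
      rw [mul_add, add_mul, mul_smul_comm, smul_mul_assoc, mul_one, hee]
    refine ⟨(‖t‖ : ℂ) - ‖s‖, ?_⟩
    rw [sub_smul, ← h2, h3, add_sub_cancel_right]
  obtain ⟨c, hc⟩ := key (a + star a) (by rw [star_add, star_star, add_comm])
  obtain ⟨d, hd⟩ := key (Complex.I • (a - star a)) (by
    rw [star_smul, star_sub, star_star, Complex.star_def, Complex.conj_I, neg_smul, ← smul_neg,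
      neg_sub])
  refine ⟨(c - Complex.I * d) / 2, ?_⟩
  have h : a = (1 / 2 : ℂ) • ((a + star a) - Complex.I • (Complex.I • (a - star a))) := by
    rw [smul_smul, Complex.I_mul_I]
    module
  calc e * a * e = (1 / 2 : ℂ) • (e * (a + star a) * e
        - Complex.I • (e * (Complex.I • (a - star a)) * e)) := by
        conv_lhs => rw [h]
        simp only [mul_smul_comm, smul_mul_assoc, mul_sub, sub_mul]
    _ = ((c - Complex.I * d) / 2) • e := by
        rw [hc, hd]
        module

/-- If `e` and `f` are minimal projections then `e M f` is at most one-dimensional. -/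
theorem IsMinimalProjection.exists_forall_eq_smul {e f : M.toStarSubalgebra}
    (he : IsMinimalProjection M e) (hf : IsMinimalProjection M f) :
    ∃ u : M.toStarSubalgebra, e * u = u ∧
      ∀ a : M.toStarSubalgebra, ∃ c : ℂ, ‖c‖ ≤ ‖a‖ ∧ e * a * f = c • u := by
  by_cases h0 : ∀ a : M.toStarSubalgebra, e * a * f = 0
  · exact ⟨0, mul_zero _, fun a => ⟨0, by simp, by rw [h0, smul_zero]⟩⟩
  push Not at h0
  obtain ⟨b, hb⟩ := h0
  have hes : star e = e := he.1.isSelfAdjoint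
  have hee : e * e = e := he.1.isIdempotentElem
  have hfs : star f = f := hf.1.isSelfAdjoint
  set v := e * b * f with hv
  have hvn : ‖v‖ ≠ 0 := norm_ne_zero_iff.2 hb
  have hev : e * v = v := by rw [hv, ← mul_assoc, ← mul_assoc, hee]
  obtain ⟨m, hm⟩ := he.exists_eq_smul (b * f * star (b * f))
  have hvv : v * star v = m • e := by
    rw [← hm, hv, mul_assoc e b f, star_mul, hes]; simp only [mul_assoc]
  have hm0 : m ≠ 0 := by
    rintro rfl
    rw [zero_smul] at hvv
    exact hb ((CStarRing.mul_star_self_eq_zero_iff v).1 hvv)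
  refine ⟨((‖v‖ : ℂ)⁻¹) • v, by rw [mul_smul_comm, hev], fun a => ?_⟩
  obtain ⟨c, hc⟩ := hf.exists_eq_smul (star (e * b) * (e * a))
  have hx : e * a * f = ((m⁻¹ * c) * ‖v‖) • ((‖v‖ : ℂ)⁻¹ • v) := by
    rw [smul_smul, mul_assoc (m⁻¹ * c), mul_inv_cancel₀ (by exact_mod_cast hvn), mul_one]
    have h1 : star v * (e * a * f) = c • f := by
      rw [← hc, hv, star_mul (e * b) f, hfs]; simp only [mul_assoc]
    have h2 : v * f = v := by
      rw [hv, mul_assoc, show f * f = f from hf.1.isIdempotentElem]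
    calc e * a * f = m⁻¹ • ((m • e) * (e * a * f)) := by
          rw [smul_mul_assoc, smul_smul, inv_mul_cancel₀ hm0, one_smul, ← mul_assoc, ← mul_assoc,
            hee]
      _ = m⁻¹ • (v * (c • f)) := by rw [← hvv, mul_assoc, h1]
      _ = (m⁻¹ * c) • v := by rw [mul_smul_comm, h2, smul_smul]
  refine ⟨_, ?_, hx⟩
  have hu : ‖((‖v‖ : ℂ)⁻¹) • v‖ = 1 := by
    rw [norm_smul, norm_inv, Complex.norm_real, norm_norm, inv_mul_cancel₀ hvn]
  calc ‖m⁻¹ * c * ‖v‖‖ = ‖e * a * f‖ := by rw [hx, norm_smul, hu, mul_one]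
    _ ≤ ‖e‖ * ‖a‖ * ‖f‖ := (norm_mul_le _ _).trans (by gcongr; exact norm_mul_le _ _)
    _ ≤ 1 * ‖a‖ * 1 := by
        gcongr
        · exact IsStarProjection.norm_le e he.1
        · exact IsStarProjection.norm_le f hf.1
    _ = ‖a‖ := by ring

/-- In a direct sum of type I factors every nonzero projection dominates a minimal one: it does not
vanish on some summand `z`, whose minimal projection `e` has central support `z`, and the polar part
of a nonzero element of `p M e` is a partial isometry from `e` into `p`. -/
theorem exists_minimal_le (hM : IsDirectSumOfTypeIFactors M) {p : M.toStarSubalgebra}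
    (hp : IsStarProjection p) (hp0 : p ≠ 0) :
    ∃ f, IsMinimalProjection M f ∧ p * f = f := by
  obtain ⟨Z, hZ, -, hsum⟩ := hM
  obtain ⟨z, hz, hpz⟩ : ∃ z ∈ Z, p * z ≠ 0 := by
    by_contra! hcon
    refine hp0 (Subtype.ext (ContinuousLinearMap.ext fun h => ?_))
    refine ((hsum h).mapL (p : H →L[ℂ] H)).unique ?_
    refine hasSum_zero.congr_fun fun z => ?_
    exact congr($(congrArg Subtype.val (hcon z z.2)) h)
  obtain ⟨-, hzc, -, hfac, e, he, hze⟩ := hZ z hz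
  have hes : star e = e := he.1.isSelfAdjoint
  have hee : e * e = e := he.1.isIdempotentElem
  obtain ⟨a, ha⟩ : ∃ a : M.toStarSubalgebra, p * a * e ≠ 0 := by
    by_contra! hcon
    -- the central support of `e`: the projection onto the closed span of `M e H`
    let K : Submodule ℂ H := Submodule.span ℂ
      {v | ∃ (x : M.toStarSubalgebra) (h : H), v = ((x * e : M.toStarSubalgebra) : H →L[ℂ] H) h}
    have hK1 (y : H →L[ℂ] H) (hy : y ∈ M.commutant) (v : H) (hv : v ∈ K) : y v ∈ K := by
      rw [VonNeumannAlgebra.mem_commutant_iff] at hy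
      have : K ≤ K.comap (y : H →ₗ[ℂ] H) := by
        refine Submodule.span_le.2 ?_
        rintro _ ⟨x, h, rfl⟩
        refine Submodule.subset_span ⟨x, y h, ?_⟩
        exact congr($((hy _ (x * e).2).symm) h)
      exact this hv
    have hK2 (y : H →L[ℂ] H) (hy : y ∈ M.commutant.commutant) (v : H) (hv : v ∈ K) : y v ∈ K := by
      rw [M.commutant_commutant] at hy
      have : K ≤ K.comap (y : H →ₗ[ℂ] H) := by
        refine Submodule.span_le.2 ?_
        rintro _ ⟨x, h, rfl⟩
        exact Submodule.subset_span ⟨⟨y, hy⟩ * x, h, rfl⟩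
      exact this hv
    obtain ⟨c, hcM, hc, hcK, hcz, hcdef⟩ := exists_projection_of_invariant M K hK1
    obtain ⟨c', hcM', -, -, -, hcdef'⟩ := exists_projection_of_invariant M.commutant K hK2
    obtain rfl : c = c' := hcdef.trans hcdef'.symm
    rw [VonNeumannAlgebra.mem_commutant_iff] at hcM'
    let C : M.toStarSubalgebra := ⟨c, hcM⟩
    have hzC : z * C = C := by
      have := hcz (1 - (z : H →L[ℂ] H)) (fun v hv => by
        have : K ≤ LinearMap.ker ((1 - (z : H →L[ℂ] H) : H →L[ℂ] H) : H →ₗ[ℂ] H) := by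
          refine Submodule.span_le.2 ?_
          rintro _ ⟨x, h, rfl⟩
          have : (1 - z) * (x * e) = 0 := by
            rw [sub_mul, one_mul, ← mul_assoc z, hzc, mul_assoc, hze, sub_self]
          exact congr($(congrArg Subtype.val this) h)
        exact this hv)
      rw [sub_mul, one_mul, sub_eq_zero] at this
      exact Subtype.ext this.symm
    obtain ⟨t, ht⟩ := hfac C hzC fun y _ => Subtype.ext (hcM' y y.2).symm
    have hpC : p * C = 0 := by
      refine Subtype.ext (hcz (p : H →L[ℂ] H) fun v hv => ?_)
      have : K ≤ LinearMap.ker (((p : H →L[ℂ] H) : H →L[ℂ] H) : H →ₗ[ℂ] H) := by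
        refine Submodule.span_le.2 ?_
        rintro _ ⟨x, h, rfl⟩
        exact congr($(congrArg Subtype.val ((mul_assoc p x e).symm.trans (hcon x))) h)
      exact this hv
    have hCe : C * e = e := Subtype.ext (ContinuousLinearMap.ext fun h =>
      hcK _ (Submodule.subset_span ⟨1, h, by rw [one_mul]; rfl⟩))
    have ht0 : t ≠ 0 := by
      rintro rfl
      rw [ht, zero_smul, zero_mul] at hCe
      exact he.2.1 hCe.symm
    rw [ht, mul_smul_comm, smul_eq_zero] at hpC
    exact hpz (hpC.resolve_left ht0)
  set v := p * a * e with hv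
  have hve : v * e = v := by rw [hv, mul_assoc, hee]
  have hpv : p * v = v := by
    rw [hv, ← mul_assoc, ← mul_assoc, show p * p = p from hp.isIdempotentElem]
  obtain ⟨l, hl⟩ := he.exists_eq_smul (star (p * a) * (p * a))
  have hvv : star v * v = l • e := by
    rw [← hl, hv, star_mul (p * a) e, hes]; simp only [mul_assoc]
  have hl0 : l ≠ 0 := by
    rintro rfl
    rw [zero_smul] at hvv
    exact ha ((CStarRing.star_mul_self_eq_zero_iff v).1 hvv)
  have hls : star l = l := by
    have := congrArg star hvv
    rw [star_mul, star_star, hvv, star_smul, hes] at this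
    exact (smul_left_injective ℂ he.2.1 this).symm
  have hff : (v * star v) * (v * star v) = l • (v * star v) := by
    calc (v * star v) * (v * star v) = v * (star v * v) * star v := by simp only [mul_assoc]
      _ = l • (v * star v) := by rw [hvv, mul_smul_comm, hve, smul_mul_assoc]
  refine ⟨l⁻¹ • (v * star v), ⟨⟨?_, ?_⟩, ?_, fun g hg hgf => ?_⟩, ?_⟩
  · rw [IsIdempotentElem, smul_mul_smul_comm, hff, smul_smul, mul_assoc, inv_mul_cancel₀ hl0,
      mul_one]
  · rw [isSelfAdjoint_iff, star_smul, star_mul, star_star, star_inv₀, hls]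
  · exact smul_ne_zero (inv_ne_zero hl0)
      (fun h => ha ((CStarRing.mul_star_self_eq_zero_iff v).1 h))
  · set f := l⁻¹ • (v * star v) with hf
    have hfs : star f = f := by rw [hf, star_smul, star_mul, star_star, star_inv₀, hls]
    have hfg : f * g = g := by
      have := congrArg star hgf
      rwa [star_mul, hfs, show star g = g from hg.isSelfAdjoint] at this
    obtain ⟨d, hd⟩ := he.exists_eq_smul (star (p * a) * g * (p * a))
    have hd' : star v * g * v = d • e := by
      rw [← hd, hv, star_mul (p * a) e, hes]; simp only [mul_assoc]
    have hgd : g = (l⁻¹ * d) • f := by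
      calc g = f * g * f := by rw [hfg, hgf]
        _ = (l⁻¹ * l⁻¹) • (v * (star v * g * v) * star v) := by
            rw [hf, smul_mul_assoc, smul_mul_assoc, mul_smul_comm, smul_smul]
            simp only [mul_assoc]
        _ = (l⁻¹ * d) • f := by
            rw [hd', mul_smul_comm, hve, smul_mul_assoc, hf, smul_smul, smul_smul]
            congr 1; ring
    rcases eq_or_ne (l⁻¹ * d) 0 with h0 | h0
    · left; rw [hgd, h0, zero_smul]
    · right
      have h1 : g * g = (l⁻¹ * d) • g := by
        conv_lhs => enter [1]; rw [hgd]
        rw [smul_mul_assoc, hfg]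
      rw [show g * g = g from hg.isIdempotentElem] at h1
      -- `g` is a nonzero multiple of `f`, and multiplying by `g` acts on both as the identity
      have h2 : (l⁻¹ * d) • f = (l⁻¹ * d) • g := by rw [← hgd]; exact h1
      exact (smul_right_injective _ h0 h2).symm
  · rw [mul_smul_comm, ← mul_assoc, hpv]

/-- Finite sums of mutually orthogonal minimal projections approximate the identity strongly: they
are taken from a maximal orthogonal family, whose ranges span a dense subspace. -/
theorem exists_finset_minimal_approx (hM : IsDirectSumOfTypeIFactors M) (h : H) {ε : ℝ}
    (hε : 0 < ε) :
    ∃ F : Finset M.toStarSubalgebra, (∀ e ∈ F, IsMinimalProjection M e) ∧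
      IsStarProjection (∑ e ∈ F, e) ∧
      ‖h - ((∑ e ∈ F, e : M.toStarSubalgebra) : H →L[ℂ] H) h‖ < ε := by
  classical
  obtain ⟨E, hE⟩ := zorn_subset {E : Set M.toStarSubalgebra |
      (∀ e ∈ E, IsMinimalProjection M e) ∧ E.Pairwise fun e f => e * f = 0} (by
    intro c hc hchain
    refine ⟨⋃₀ c, ⟨?_, ?_⟩, fun s hs => Set.subset_sUnion_of_mem hs⟩
    · rintro e ⟨s, hs, hes⟩
      exact (hc hs).1 e hes
    · exact (Set.pairwise_sUnion hchain.directedOn).2 fun s hs => (hc hs).2)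
  have hEmin := hE.prop.1
  have hEorth := hE.prop.2
  let R : E → Submodule ℂ H := fun e =>
    LinearMap.range (((e : M.toStarSubalgebra) : H →L[ℂ] H) : H →ₗ[ℂ] H)
  let K : Submodule ℂ H := ⨆ e, R e
  obtain ⟨q, hqM, hq, hqK, hqz, hqdef⟩ := exists_projection_of_invariant M K (by
    intro y hy v hv
    rw [VonNeumannAlgebra.mem_commutant_iff] at hy
    have : K ≤ K.comap (y : H →ₗ[ℂ] H) := by
      refine iSup_le fun e => ?_
      rintro _ ⟨w, rfl⟩
      refine Submodule.mem_iSup_of_mem e ⟨y w, ?_⟩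
      exact congr($(hy _ (e : M.toStarSubalgebra).2) w)
    exact this hv)
  have hq1 : (⟨q, hqM⟩ : M.toStarSubalgebra) = 1 := by
    have hQ : IsStarProjection (⟨q, hqM⟩ : M.toStarSubalgebra) :=
      ⟨Subtype.ext hq.isIdempotentElem, Subtype.ext hq.isSelfAdjoint⟩
    by_contra hne
    -- otherwise a minimal projection below `1 - q` could be added to `E`
    obtain ⟨f, hf, hqf⟩ := exists_minimal_le hM hQ.one_sub
      (fun h => hne (sub_eq_zero.1 h).symm)
    have hqf' : (⟨q, hqM⟩ : M.toStarSubalgebra) * f = 0 := by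
      rwa [sub_mul, one_mul, sub_eq_self] at hqf
    have hfs : star f = f := hf.1.isSelfAdjoint
    have hfe : ∀ e ∈ E, e * f = 0 := by
      intro e he
      have h1 : (⟨q, hqM⟩ : M.toStarSubalgebra) * e = e :=
        Subtype.ext (ContinuousLinearMap.ext fun w =>
          hqK _ (Submodule.mem_iSup_of_mem ⟨e, he⟩ ⟨w, rfl⟩))
      have h2 := congrArg star h1
      rw [star_mul, show star e = e from (hEmin e he).1.isSelfAdjoint,
        show star (⟨q, hqM⟩ : M.toStarSubalgebra) = ⟨q, hqM⟩ from hQ.isSelfAdjoint] at h2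
      rw [← h2, mul_assoc, hqf', mul_zero]
    have hmem : f ∈ E := by
      refine hE.le_of_ge (y := insert f E) ⟨?_, ?_⟩ (Set.subset_insert f E) (Set.mem_insert f E)
      · rintro e (rfl | he)
        · exact hf
        · exact hEmin e he
      · refine hEorth.insert fun e he _ => ⟨?_, hfe e he⟩
        have := congrArg star (hfe e he)
        rwa [star_mul, hfs, show star e = e from (hEmin e he).1.isSelfAdjoint, star_zero] at this
    have := hfe f hmem
    rw [show f * f = f from hf.1.isIdempotentElem] at this
    exact hf.2.1 this
  have hh : h ∈ K.topologicalClosure := by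
    have h1 : q h = h := congr($(congrArg Subtype.val hq1) h)
    have : CompleteSpace K.topologicalClosure := K.isClosed_topologicalClosure.completeSpace_coe
    rw [hqdef] at h1
    exact Submodule.starProjection_eq_self_iff.1 h1
  obtain ⟨k, hk, hd⟩ := Metric.mem_closure_iff.1 hh ε hε
  obtain ⟨s, hs⟩ := Submodule.mem_iSup_iff_exists_finset.1 (show k ∈ ⨆ e, R e from hk)
  have hF (e : M.toStarSubalgebra) (he : e ∈ s.image Subtype.val) : e ∈ E := by
    obtain ⟨e, -, rfl⟩ := Finset.mem_image.1 he
    exact e.2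
  have hmul {e : M.toStarSubalgebra} (he : e ∈ s.image Subtype.val) :
      (∑ f ∈ s.image Subtype.val, f) * e = e := by
    rw [Finset.sum_mul, Finset.sum_eq_single_of_mem e he fun f hf hne => hEorth (hF f hf) (hF e he)
      hne]
    exact (hEmin e (hF e he)).1.isIdempotentElem
  have hp : IsStarProjection (∑ e ∈ s.image Subtype.val, e) := by
    refine ⟨?_, ?_⟩
    · rw [IsIdempotentElem, Finset.mul_sum]
      exact Finset.sum_congr rfl fun e he => hmul he
    · rw [isSelfAdjoint_iff, star_sum]
      exact Finset.sum_congr rfl fun e he => (hEmin e (hF e he)).1.isSelfAdjoint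
  refine ⟨s.image Subtype.val, fun e he => hEmin e (hF e he), hp, ?_⟩
  set p := ∑ e ∈ s.image Subtype.val, e with hpdef
  have hpk : (p : H →L[ℂ] H) k = k := by
    have : ⨆ e ∈ s, R e ≤ LinearMap.ker ((1 - (p : H →L[ℂ] H) : H →L[ℂ] H) : H →ₗ[ℂ] H) := by
      refine iSup₂_le fun e he => ?_
      rintro _ ⟨w, rfl⟩
      have : (1 - p) * (e : M.toStarSubalgebra) = 0 := by
        rw [sub_mul, one_mul, hmul (Finset.mem_image_of_mem _ he), sub_self]
      exact congr($(congrArg Subtype.val this) w)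
    exact (sub_eq_zero.1 (show k - (p : H →L[ℂ] H) k = 0 from this hs)).symm
  calc ‖h - (p : H →L[ℂ] H) h‖ = ‖((1 - p : M.toStarSubalgebra) : H →L[ℂ] H) (h - k)‖ := by
        congr 1
        change _ = (h - k) - (p : H →L[ℂ] H) (h - k)
        rw [map_sub, hpk]; abel
    _ ≤ ‖(1 - p : M.toStarSubalgebra)‖ * ‖h - k‖ := ContinuousLinearMap.le_opNorm _ _
    _ ≤ 1 * ‖h - k‖ := by gcongr; exact IsStarProjection.norm_le _ hp.one_sub
    _ < ε := by rwa [one_mul, ← dist_eq_norm]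

end Atoms

/-! ### Positive functionals and norm convergence in the predual -/

section PositiveFunctionals

variable {H : Type*} [NormedAddCommGroup H] [InnerProductSpace ℂ H] [CompleteSpace H]
variable {M : VonNeumannAlgebra H}

/-- A positive linear functional on `M`. -/
def IsPositiveFunctional (σ : M.toStarSubalgebra →ₗ[ℂ] ℂ) : Prop :=
  ∀ x : M.toStarSubalgebra, (x : H →L[ℂ] H).IsPositive → 0 ≤ σ x

theorem isPositive_star_mul_self (x : M.toStarSubalgebra) :
    ((star x * x : M.toStarSubalgebra) : H →L[ℂ] H).IsPositive :=
  (ContinuousLinearMap.nonneg_iff_isPositive _).1 (star_mul_self_nonneg (x : H →L[ℂ] H))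

theorem isPositive_norm_sq_sub_star_mul_self (x : M.toStarSubalgebra) :
    ((((‖x‖ ^ 2 : ℝ) : ℂ) • 1 - star x * x : M.toStarSubalgebra) : H →L[ℂ] H).IsPositive := by
  refine (ContinuousLinearMap.nonneg_iff_isPositive _).1 (sub_nonneg.2 ?_)
  have h := CStarAlgebra.star_mul_le_algebraMap_norm_sq (a := (x : H →L[ℂ] H))
  rw [Algebra.algebraMap_eq_smul_one, ← Complex.coe_smul] at h
  exact h

namespace IsPositiveFunctional

variable {σ : M.toStarSubalgebra →ₗ[ℂ] ℂ} (hσ : IsPositiveFunctional σ)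

include hσ

theorem star_mul_self_nonneg (x : M.toStarSubalgebra) : 0 ≤ σ (star x * x) :=
  hσ _ (isPositive_star_mul_self x)

theorem one_nonneg : 0 ≤ σ 1 := by simpa using hσ.star_mul_self_nonneg 1

theorem conj_apply (x y : M.toStarSubalgebra) :
    (starRingEnd ℂ) (σ (star y * x)) = σ (star x * y) := by
  have h1 := (Complex.nonneg_iff.1 (hσ.star_mul_self_nonneg (x + y))).2
  have h2 := (Complex.nonneg_iff.1 (hσ.star_mul_self_nonneg (x + Complex.I • y))).2
  have hx := (Complex.nonneg_iff.1 (hσ.star_mul_self_nonneg x)).2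
  have hy := (Complex.nonneg_iff.1 (hσ.star_mul_self_nonneg y)).2
  simp only [star_add, star_smul, add_mul, mul_add, map_add, smul_mul_assoc, mul_smul_comm,
    map_smul, smul_eq_mul, Complex.star_def, Complex.conj_I, Complex.add_im, Complex.mul_im,
    Complex.neg_re, Complex.neg_im, Complex.I_re, Complex.I_im, Complex.mul_re] at h1 h2
  apply Complex.ext
  · rw [Complex.conj_re]; linarith
  · rw [Complex.conj_im]; linarith

/-- The Cauchy–Schwarz inequality for a positive functional. -/
theorem norm_star_mul_le (x y : M.toStarSubalgebra) :
    ‖σ (star x * y)‖ ≤ √(σ (star x * x)).re * √(σ (star y * y)).re := by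
  let c : PreInnerProductSpace.Core ℂ M.toStarSubalgebra :=
    { inner := fun x y => σ (star x * y)
      conj_inner_symm := fun x y => hσ.conj_apply x y
      re_inner_nonneg := fun x => (Complex.nonneg_iff.1 (hσ.star_mul_self_nonneg x)).1
      add_left := fun x y z => by rw [star_add, add_mul, map_add]
      smul_left := fun x y r => by rw [star_smul, smul_mul_assoc, map_smul]; rfl }
  exact InnerProductSpace.Core.norm_inner_le_norm (c := c) x y

theorem re_star_mul_self_le (x : M.toStarSubalgebra) :
    (σ (star x * x)).re ≤ ‖x‖ ^ 2 * (σ 1).re := by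
  have := (Complex.nonneg_iff.1 (hσ _ (isPositive_norm_sq_sub_star_mul_self x))).1
  rw [map_sub, map_smul, smul_eq_mul, Complex.sub_re, Complex.re_ofReal_mul] at this
  linarith

theorem sqrt_re_star_mul_self_le (x : M.toStarSubalgebra) :
    √(σ (star x * x)).re ≤ ‖x‖ * √(σ 1).re := by
  calc √(σ (star x * x)).re ≤ √(‖x‖ ^ 2 * (σ 1).re) := Real.sqrt_le_sqrt (hσ.re_star_mul_self_le x)
    _ = ‖x‖ * √(σ 1).re := by rw [Real.sqrt_mul (sq_nonneg _), Real.sqrt_sq (norm_nonneg _)]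

theorem norm_apply_le (x : M.toStarSubalgebra) : ‖σ x‖ ≤ ‖x‖ * (σ 1).re := by
  have h1 : 0 ≤ (σ 1).re := (Complex.nonneg_iff.1 hσ.one_nonneg).1
  calc ‖σ x‖ = ‖σ (star 1 * x)‖ := by rw [star_one, one_mul]
    _ ≤ √(σ (star 1 * 1)).re * √(σ (star x * x)).re := hσ.norm_star_mul_le 1 x
    _ ≤ √(σ 1).re * (‖x‖ * √(σ 1).re) := by
        rw [star_one, one_mul]
        gcongr
        exact hσ.sqrt_re_star_mul_self_le x
    _ = ‖x‖ * (σ 1).re := by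
        rw [mul_left_comm, Real.mul_self_sqrt h1]

/-- A positive functional that is small on `1 - p` is close to its compression by `p`, with an error
controlled by its values at `1` and `1 - p` alone. -/
theorem norm_sub_compress_le {p : M.toStarSubalgebra} (hp : IsStarProjection p)
    (a : M.toStarSubalgebra) :
    ‖σ a - σ (p * a * p)‖ ≤ 2 * ‖a‖ * (√(σ (1 - p)).re * √(σ 1).re) := by
  have hps : star p = p := hp.isSelfAdjoint
  have hq := hp.one_sub
  have hqs : star (1 - p) = 1 - p := hq.isSelfAdjoint
  have hqq : star (1 - p) * (1 - p) = 1 - p := by rw [hqs]; exact hq.isIdempotentElem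
  have hdec : σ a - σ (p * a * p) =
      σ (star (1 - p) * a) + σ (star (star a * p) * (1 - p)) := by
    rw [← map_sub, ← map_add, hqs, star_mul, star_star, hps]
    congr 1
    noncomm_ring
  have h1 : ‖σ (star (1 - p) * a)‖ ≤ √(σ (1 - p)).re * (‖a‖ * √(σ 1).re) := by
    refine (hσ.norm_star_mul_le _ _).trans ?_
    rw [hqq]
    gcongr
    exact hσ.sqrt_re_star_mul_self_le a
  have h2 : ‖σ (star (star a * p) * (1 - p))‖ ≤ (‖a‖ * √(σ 1).re) * √(σ (1 - p)).re := by
    refine (hσ.norm_star_mul_le _ _).trans ?_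
    rw [hqq]
    gcongr
    refine (hσ.sqrt_re_star_mul_self_le _).trans ?_
    gcongr
    calc ‖star a * p‖ ≤ ‖star a‖ * ‖p‖ := norm_mul_le _ _
      _ ≤ ‖a‖ * 1 := by rw [norm_star]; gcongr; exact IsStarProjection.norm_le p hp
      _ = ‖a‖ := mul_one _
  rw [hdec]
  refine (norm_add_le _ _).trans ?_
  linarith

end IsPositiveFunctional

theorem isPositiveFunctional_vectorFunctional (h : H) :
    IsPositiveFunctional (vectorFunctional M h h : M.toStarSubalgebra →ₗ[ℂ] ℂ) :=
  fun _ hx => hx.inner_nonneg_right h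

theorem mem_compactElements {e : M.toStarSubalgebra} (he : IsMinimalProjection M e)
    (a b : M.toStarSubalgebra) : a * e * b ∈ compactElements M :=
  subset_closure (Submodule.subset_span ⟨a, e, b, he, rfl⟩)

/-- A Kadec–Klee property of the predual of a direct sum of type I factors: if positive functionals
converge to a vector state pointwise on the compact elements and at `1`, then they converge in norm.
Choose a finite sum `p` of orthogonal minimal projections that nearly carries the limit; then it
nearly carries the approximating functionals too, and on `p M p`, which is finite-dimensional,
pointwise convergence is uniform on the unit ball. -/
theorem tendsto_vectorFunctional_of_compact (hM : IsDirectSumOfTypeIFactors M) (h : H)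
    {ι : Type*} {l : Filter ι} {σ : ι → StrongDual ℂ M.toStarSubalgebra}
    (hσ : ∀ i, IsPositiveFunctional (σ i : M.toStarSubalgebra →ₗ[ℂ] ℂ))
    (hcomp : ∀ x ∈ compactElements M,
      Tendsto (fun i => σ i x) l (𝓝 (vectorFunctional M h h x)))
    (hone : Tendsto (fun i => σ i 1) l (𝓝 (vectorFunctional M h h 1))) :
    Tendsto σ l (𝓝 (vectorFunctional M h h)) := by
  rw [Metric.tendsto_nhds]
  intro ε hε
  set ω := vectorFunctional M h h with hω
  have hωpos : IsPositiveFunctional (ω : M.toStarSubalgebra →ₗ[ℂ] ℂ) :=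
    isPositiveFunctional_vectorFunctional h
  obtain ⟨D, hD⟩ : ∃ D, D = (ω 1).re + 1 := ⟨_, rfl⟩
  have hω1 : 0 ≤ (ω 1).re := (Complex.nonneg_iff.1 hωpos.one_nonneg).1
  have hD0 : 0 < D := by linarith
  have hsD : 0 < √D := Real.sqrt_pos.2 hD0
  set δ := ε / (16 * √D) with hδ
  have hδ0 : 0 < δ := by positivity
  obtain ⟨F, hF, hp, hFh⟩ := exists_finset_minimal_approx hM h hδ0
  set p := ∑ e ∈ F, e with hpdef
  have hωp : (ω (1 - p)).re < δ ^ 2 := by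
    -- `⟪h, (1 - p) h⟫ = ‖(1 - p) h‖²`
    have hq := hp.one_sub
    have hqq : star (1 - p) * (1 - p) = 1 - p := by
      rw [show star (1 - p) = 1 - p from hq.isSelfAdjoint]; exact hq.isIdempotentElem
    have : ω (1 - p) = ((‖h - (p : H →L[ℂ] H) h‖ ^ 2 : ℝ) : ℂ) := by
      rw [← hqq, hω, vectorFunctional_apply]
      change inner ℂ h (ContinuousLinearMap.adjoint ((1 - p : M.toStarSubalgebra) : H →L[ℂ] H)
        (h - (p : H →L[ℂ] H) h)) = _
      rw [ContinuousLinearMap.adjoint_inner_right]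
      change inner ℂ (h - (p : H →L[ℂ] H) h) (h - (p : H →L[ℂ] H) h) = _
      rw [inner_self_eq_norm_sq_to_K]
      norm_cast
    rw [this, Complex.ofReal_re]
    gcongr
  have hre {x : M.toStarSubalgebra} (hx : Tendsto (fun i => σ i x) l (𝓝 (ω x))) :
      Tendsto (fun i => (σ i x).re) l (𝓝 (ω x).re) :=
    (Complex.continuous_re.tendsto _).comp hx
  have hσe : ∀ e ∈ F, Tendsto (fun i => σ i e) l (𝓝 (ω e)) := fun e he => hcomp e (by
    simpa using mem_compactElements (hF e he) 1 1)
  have hσp : Tendsto (fun i => σ i (1 - p)) l (𝓝 (ω (1 - p))) := by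
    simp only [hpdef, map_sub, map_sum]
    exact hone.sub (tendsto_finsetSum F hσe)
  choose! u hu hue using fun (q : M.toStarSubalgebra × M.toStarSubalgebra) (hq : q ∈ F ×ˢ F) =>
    (hF q.1 (Finset.mem_product.1 hq).1).exists_forall_eq_smul (hF q.2 (Finset.mem_product.1 hq).2)
  have hσu : Tendsto (fun i => ∑ q ∈ F ×ˢ F, ‖σ i (u q) - ω (u q)‖) l (𝓝 0) := by
    rw [← Finset.sum_const_zero (ι := M.toStarSubalgebra × M.toStarSubalgebra) (s := F ×ˢ F)]
    refine tendsto_finsetSum _ fun q hq => ?_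
    have : Tendsto (fun i => σ i (u q)) l (𝓝 (ω (u q))) := hcomp _ (by
      have := mem_compactElements (hF q.1 (Finset.mem_product.1 hq).1) 1 (u q)
      rwa [one_mul, hu q hq] at this)
    exact (tendsto_iff_norm_sub_tendsto_zero.1 this)
  filter_upwards [(hre hone).eventually_lt_const (show (ω 1).re < D by linarith),
    (hre hσp).eventually_lt_const hωp, hσu.eventually_lt_const (show (0 : ℝ) < ε / 4 by positivity)]
    with i hi1 hip hiu
  have hcompress {τ : StrongDual ℂ M.toStarSubalgebra}
      (hτ : IsPositiveFunctional (τ : M.toStarSubalgebra →ₗ[ℂ] ℂ)) (h1 : (τ 1).re ≤ D)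
      (hτp : (τ (1 - p)).re ≤ δ ^ 2) (a : M.toStarSubalgebra) :
      ‖τ a - τ (p * a * p)‖ ≤ ε / 8 * ‖a‖ := by
    calc ‖τ a - τ (p * a * p)‖ ≤ 2 * ‖a‖ * (√(τ (1 - p)).re * √(τ 1).re) :=
          hτ.norm_sub_compress_le hp a
      _ ≤ 2 * ‖a‖ * (√(δ ^ 2) * √D) := by gcongr
      _ = ε / 8 * ‖a‖ := by
          rw [Real.sqrt_sq hδ0.le, hδ]
          field_simp
          ring
  have hfin (a : M.toStarSubalgebra) :
      ‖σ i (p * a * p) - ω (p * a * p)‖ ≤ ε / 4 * ‖a‖ := by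
    have hpap : p * a * p = ∑ q ∈ F ×ˢ F, q.1 * a * q.2 := by
      rw [hpdef, Finset.sum_mul, Finset.sum_mul_sum, Finset.sum_product]
    calc ‖σ i (p * a * p) - ω (p * a * p)‖
        = ‖∑ q ∈ F ×ˢ F, (σ i (q.1 * a * q.2) - ω (q.1 * a * q.2))‖ := by
          rw [hpap, map_sum, map_sum, Finset.sum_sub_distrib]
      _ ≤ ∑ q ∈ F ×ˢ F, ‖σ i (u q) - ω (u q)‖ * ‖a‖ := by
          refine norm_sum_le_of_le _ fun q hq => ?_
          obtain ⟨c, hc, hca⟩ := hue q hq a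
          rw [hca, map_smul, map_smul, ← smul_sub, norm_smul, mul_comm]
          gcongr
      _ ≤ ε / 4 * ‖a‖ := by
          rw [← Finset.sum_mul]
          gcongr
  rw [dist_eq_norm]
  refine lt_of_le_of_lt (ContinuousLinearMap.opNorm_le_bound _ (by positivity : 0 ≤ ε / 2)
    fun a => ?_) (half_lt_self hε)
  have e1 := hcompress (hσ i) hi1.le hip.le a
  have e2 := hcompress hωpos (by linarith) hωp.le a
  have e3 := hfin a
  calc ‖(σ i - ω) a‖ = ‖(σ i a - σ i (p * a * p)) + (σ i (p * a * p) - ω (p * a * p))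
        - (ω a - ω (p * a * p))‖ := by
        congr 1
        rw [sub_apply]
        ring
    _ ≤ ε / 8 * ‖a‖ + ε / 4 * ‖a‖ + ε / 8 * ‖a‖ :=
        (norm_sub_le _ _).trans (add_le_add ((norm_add_le _ _).trans (add_le_add e1 e3)) e2)
    _ = ε / 2 * ‖a‖ := by ring

end PositiveFunctionals

/-! ### Norm bounds for positive maps -/

section PositiveMaps

/-- The norm of an operator is at most twice its numerical radius. -/
theorem norm_le_of_forall_norm_inner_le {E : Type*} [NormedAddCommGroup E]
    [InnerProductSpace ℂ E] {T : E →L[ℂ] E} {c : ℝ} (hc : 0 ≤ c)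
    (hT : ∀ h, ‖inner ℂ (T h) h‖ ≤ c * ‖h‖ ^ 2) : ‖T‖ ≤ 2 * c := by
  have key (x y : E) (hx : ‖x‖ = 1) (hy : ‖y‖ = 1) : ‖inner ℂ (T y) x‖ ≤ 2 * c := by
    rw [show inner ℂ (T y) x = _ from inner_map_polarization (T : E →ₗ[ℂ] E) x y, norm_div]
    have h1 := hT (x + y)
    have h2 := hT (x - y)
    have h3 := hT (x + Complex.I • y)
    have h4 := hT (x - Complex.I • y)
    have p1 := parallelogram_law_with_norm ℂ x y
    have p2 := parallelogram_law_with_norm ℂ x (Complex.I • y)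
    rw [norm_smul, Complex.norm_I, one_mul] at p2
    rw [hx, hy] at p1 p2
    rw [div_le_iff₀ (by norm_num), Complex.norm_ofNat]
    refine (norm_sub_le _ _).trans ?_
    rw [norm_mul, Complex.norm_I, one_mul]
    have h5 := norm_add_le (inner ℂ (T (x + y)) (x + y) - inner ℂ (T (x - y)) (x - y))
      (Complex.I * inner ℂ (T (x + Complex.I • y)) (x + Complex.I • y))
    rw [norm_mul, Complex.norm_I, one_mul] at h5
    have h6 := norm_sub_le (inner ℂ (T (x + y)) (x + y)) (inner ℂ (T (x - y)) (x - y))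
    simp only [ContinuousLinearMap.coe_coe] at *
    nlinarith
  refine ContinuousLinearMap.opNorm_le_of_unit_norm (𝕜 := ℂ) (by positivity) fun y hy => ?_
  rcases eq_or_ne (T y) 0 with h0 | h0
  · rw [h0, norm_zero]; positivity
  have hn : ‖T y‖ ≠ 0 := norm_ne_zero_iff.2 h0
  have := key (((‖T y‖⁻¹ : ℝ) : ℂ) • T y) y (by
    rw [norm_smul, Complex.norm_real, norm_inv, norm_norm, inv_mul_cancel₀ hn]) hy
  rwa [inner_smul_right, inner_self_eq_norm_sq_to_K, norm_mul, Complex.norm_real, norm_inv,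
    norm_norm, norm_pow, RCLike.norm_ofReal, abs_norm, pow_two, ← mul_assoc, inv_mul_cancel₀ hn,
    one_mul] at this

variable {H : Type*} [NormedAddCommGroup H] [InnerProductSpace ℂ H] [CompleteSpace H]
variable {M : VonNeumannAlgebra H}

theorem IsPositiveMap.isPositiveFunctional_comp
    {φ : M.toStarSubalgebra →ₗ[ℂ] M.toStarSubalgebra} (hφ : IsPositiveMap M φ)
    {σ : M.toStarSubalgebra →ₗ[ℂ] ℂ} (hσ : IsPositiveFunctional σ) :
    IsPositiveFunctional (σ ∘ₗ φ) :=
  fun x hx => hσ _ (hφ x hx)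

theorem IsPositiveMap.norm_apply_le {φ : M.toStarSubalgebra →ₗ[ℂ] M.toStarSubalgebra}
    (hφ : IsPositiveMap M φ) (x : M.toStarSubalgebra) : ‖φ x‖ ≤ 2 * ‖φ 1‖ * ‖x‖ := by
  have : ‖(φ x : H →L[ℂ] H)‖ ≤ 2 * (‖φ 1‖ * ‖x‖) := by
    refine norm_le_of_forall_norm_inner_le (by positivity) fun h => ?_
    have h1 := (hφ.isPositiveFunctional_comp
      (isPositiveFunctional_vectorFunctional h)).norm_apply_le x
    have h2 : (vectorFunctional M h h (φ 1)).re ≤ ‖h‖ * ‖h‖ * ‖φ 1‖ :=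
      (Complex.re_le_norm _).trans ((ContinuousLinearMap.le_opNorm _ _).trans
        (by gcongr; exact norm_vectorFunctional_le M h h))
    rw [← inner_conj_symm, RCLike.norm_conj]
    calc ‖inner ℂ h ((φ x : H →L[ℂ] H) h)‖ ≤ ‖x‖ * (vectorFunctional M h h (φ 1)).re := h1
      _ ≤ ‖x‖ * (‖h‖ * ‖h‖ * ‖φ 1‖) := by gcongr
      _ = ‖φ 1‖ * ‖x‖ * ‖h‖ ^ 2 := by ring
  rw [mul_assoc]
  exact this

/-- Operators converging in the weak operator topology along a countably generated filter are
eventually bounded, by the uniform boundedness principle applied to sequences. -/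
theorem exists_eventually_norm_le {ι : Type*} {l : Filter ι} [l.IsCountablyGenerated]
    {A : ι → H →L[ℂ] H} {B : H →L[ℂ] H}
    (hA : ∀ h g : H, Tendsto (fun i => inner ℂ g (A i h)) l (𝓝 (inner ℂ g (B h)))) :
    ∃ C, ∀ᶠ i in l, ‖A i‖ ≤ C := by
  by_contra! hcon
  obtain ⟨U, hU⟩ := l.exists_antitone_basis
  have hfreq (n : ℕ) : ∃ i ∈ U n, (n : ℝ) < ‖A i‖ := by
    have h := hcon n
    by_contra! hn
    exact h (Filter.eventually_of_mem (hU.mem n) fun i hi => (hn i hi).not_gt)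
  choose s hsU hs using hfreq
  have hsl : Tendsto s atTop l := hU.tendsto hsU
  obtain ⟨C, hC⟩ : ∃ C, ∀ n, ‖A (s n)‖ ≤ C := by
    refine banach_steinhaus fun h => ?_
    have : ∃ C, ∀ n, ‖innerSL ℂ (A (s n) h)‖ ≤ C := by
      refine banach_steinhaus fun g => ?_
      obtain ⟨C, hC⟩ := ((hA h g).comp hsl).norm.bddAbove_range
      refine ⟨C, fun n => ?_⟩
      rw [innerSL_apply_apply, ← inner_conj_symm, RCLike.norm_conj]
      exact hC ⟨n, rfl⟩
    simpa only [innerSL_apply_norm] using this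
  obtain ⟨n, hn⟩ := exists_nat_gt C
  linarith [hs n, hC n]

end PositiveMaps

/-! ### Extension of operator semigroups from a dense subsemigroup -/

section Extension

variable {X : Type*} [NormedAddCommGroup X] [NormedSpace ℂ X]
variable {S : AddSubsemigroup ℝ≥0}

/-- A semigroup of operators over `S` that is bounded near `0` is bounded on bounded subsets of
`S`. -/
theorem exists_norm_le_of_eventually (hS : Dense (S : Set ℝ≥0))
    (hSsub : ∀ s ∈ S, ∀ t ∈ S, s < t → t - s ∈ S) {T : S → X →L[ℂ] X}
    (hadd : ∀ s t, T (s + t) = T s ∘L T t) {C : ℝ}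
    (hC : ∀ᶠ s in comap (fun s : S => (s : ℝ≥0)) (𝓝 0), ‖T s‖ ≤ C) (N : ℝ≥0) :
    ∃ K, ∀ s : S, (s : ℝ≥0) ≤ N → ‖T s‖ ≤ K := by
  obtain ⟨U, hU, hUC⟩ := mem_comap.1 hC
  obtain ⟨δ, hδ, hδU⟩ := NNReal.nhds_zero_basis.mem_iff.1 hU
  have hsmall (s : S) (hs : (s : ℝ≥0) < δ) : ‖T s‖ ≤ max C 1 :=
    (hUC (hδU hs) : ‖T s‖ ≤ C).trans (le_max_left _ _)
  obtain ⟨d, hdS, hd0, hdδ⟩ : ∃ d ∈ S, 0 < d ∧ d < δ := hS.exists_between hδ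
  have key (n : ℕ) : ∀ s : S, (s : ℝ≥0) ≤ n * d → ‖T s‖ ≤ max C 1 ^ (n + 1) := by
    have h1 : (1 : ℝ) ≤ max C 1 := le_max_right _ _
    induction n with
    | zero =>
      intro s hs
      rw [Nat.cast_zero, zero_mul] at hs
      simpa using hsmall s (hs.trans_lt hδ)
    | succ n ih =>
      intro s hs
      rcases lt_or_ge (s : ℝ≥0) δ with h | h
      · exact (hsmall s h).trans (le_self_pow₀ h1 (by omega))
      · have hds : d < s := hdδ.trans_le h
        let r : S := ⟨s - d, hSsub d hdS s s.2 hds⟩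
        have hsr : s = r + ⟨d, hdS⟩ := Subtype.ext (tsub_add_cancel_of_le hds.le).symm
        have hr : (r : ℝ≥0) ≤ n * d := by
          refine tsub_le_iff_right.2 (hs.trans_eq ?_)
          push_cast; ring
        rw [hsr, hadd]
        refine (ContinuousLinearMap.opNorm_comp_le _ _).trans ?_
        rw [pow_succ]
        exact mul_le_mul (ih r hr) (hsmall ⟨d, hdS⟩ hdδ) (norm_nonneg _) (by positivity)
  obtain ⟨n, hn⟩ := exists_nat_ge (N / d)
  refine ⟨_, fun s hs => key n s (hs.trans ?_)⟩
  rwa [div_le_iff₀ hd0] at hn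

/-- An operator semigroup over `S` that is strongly continuous at `0` and bounded near `0` extends
to a strongly continuous semigroup over `ℝ≥0`. Since `T s' - T s = T s (T (s' - s) - 1)` for
`s < s'`, the orbits are uniformly continuous on bounded subsets of `S`. -/
theorem exists_strongly_continuous_extension [CompleteSpace X] (hS : Dense (S : Set ℝ≥0))
    (hSsub : ∀ s ∈ S, ∀ t ∈ S, s < t → t - s ∈ S) {T : S → X →L[ℂ] X}
    (hadd : ∀ s t, T (s + t) = T s ∘L T t) {C : ℝ}
    (hC : ∀ᶠ s in comap (fun s : S => (s : ℝ≥0)) (𝓝 0), ‖T s‖ ≤ C)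
    (hlim : ∀ x, Tendsto (fun s => T s x) (comap (fun s : S => (s : ℝ≥0)) (𝓝 0)) (𝓝 x)) :
    ∃ U : ℝ≥0 → X →L[ℂ] X, U 0 = .id ℂ X ∧ (∀ s t, U (s + t) = U s ∘L U t) ∧
      (∀ x, Continuous fun t => U t x) ∧ ∀ s : S, U s = T s := by
  have hdi : IsDenseInducing (fun s : S => (s : ℝ≥0)) := hS.isDenseInducing_val
  have hbound := exists_norm_le_of_eventually hS hSsub hadd hC
  have hdiff {N : ℝ≥0} {K : ℝ} (hK : ∀ s : S, (s : ℝ≥0) ≤ N → ‖T s‖ ≤ K) (x : X) {s s' : S}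
      (hlt : (s : ℝ≥0) < s') (hN : (s : ℝ≥0) ≤ N) :
      dist (T s x) (T s' x) ≤ K * ‖T ⟨s' - s, hSsub s s.2 s' s'.2 hlt⟩ x - x‖ := by
    have hs' : s' = s + ⟨s' - s, hSsub s s.2 s' s'.2 hlt⟩ :=
      Subtype.ext (add_tsub_cancel_of_le hlt.le).symm
    rw [dist_comm, dist_eq_norm]
    conv_lhs => rw [hs', hadd, ContinuousLinearMap.comp_apply, ← map_sub]
    exact (T s).le_of_opNorm_le (hK s hN) _
  have hcauchy (x : X) (t : ℝ≥0) :
      ∃ y, Tendsto (fun s => T s x) (comap (fun s : S => (s : ℝ≥0)) (𝓝 t)) (𝓝 y) := by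
    have : (comap (fun s : S => (s : ℝ≥0)) (𝓝 t)).NeBot := hdi.comap_nhds_neBot t
    refine cauchy_map_iff_exists_tendsto.1 (Metric.cauchy_iff.2 ⟨inferInstance, fun ε hε => ?_⟩)
    obtain ⟨K₀, hK₀⟩ := hbound (t + 1)
    obtain ⟨K, hKpos, hK⟩ : ∃ K, 0 < K ∧ ∀ s : S, (s : ℝ≥0) ≤ t + 1 → ‖T s‖ ≤ K :=
      ⟨max K₀ 1, by positivity, fun s hs => (hK₀ s hs).trans (le_max_left _ _)⟩
    obtain ⟨V, hV, hVε⟩ := mem_comap.1 (Metric.tendsto_nhds.1 (hlim x) (ε / K) (by positivity))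
    obtain ⟨δ, hδ, hδV⟩ := NNReal.nhds_zero_basis.mem_iff.1 hV
    have hsmall {s s' : S} (hlt : (s : ℝ≥0) < s') (hs : (s : ℝ≥0) ≤ t + 1)
        (hss : (s' : ℝ≥0) < s + δ) : dist (T s x) (T s' x) < ε := by
      refine (hdiff hK x hlt hs).trans_lt ?_
      have := hVε (show (⟨s' - s, hSsub s s.2 s' s'.2 hlt⟩ : S) ∈ _ from
        hδV ((tsub_lt_iff_left hlt.le).2 hss))
      rw [Set.mem_ofPred_eq, dist_eq_norm, lt_div_iff₀' hKpos] at this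
      exact this
    refine ⟨_, image_mem_map (preimage_mem_comap (Metric.ball_mem_nhds t
      (show (0 : ℝ) < min (δ / 2) 1 by positivity))), ?_⟩
    have hball {s : S} (hs : (s : ℝ≥0) ∈ Metric.ball t (min ((δ : ℝ) / 2) 1)) :
        (s : ℝ) < t + δ / 2 ∧ (t : ℝ) < s + δ / 2 ∧ (s : ℝ≥0) ≤ t + 1 := by
      rw [Metric.mem_ball, NNReal.dist_eq, lt_min_iff, abs_lt, abs_lt] at hs
      refine ⟨by linarith, by linarith, ?_⟩
      rw [← NNReal.coe_le_coe]
      push_cast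
      linarith
    rintro _ ⟨s, hs, rfl⟩ _ ⟨s', hs', rfl⟩
    obtain ⟨h1, h2, h3⟩ := hball hs
    obtain ⟨h1', h2', h3'⟩ := hball hs'
    rcases lt_trichotomy (s : ℝ≥0) s' with h | h | h
    · refine hsmall h h3 ?_
      rw [← NNReal.coe_lt_coe]
      push_cast
      linarith
    · rw [Subtype.ext h, dist_self]; exact hε
    · rw [dist_comm]
      refine hsmall h h3' ?_
      rw [← NNReal.coe_lt_coe]
      push_cast
      linarith
  let E : X → ℝ≥0 → X := fun x => hdi.extend fun s => T s x
  have hEcont (x : X) : Continuous (E x) := hdi.continuous_extend (hcauchy x)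
  have hTcont (x : X) : Continuous fun s => T s x := by
    refine continuous_iff_continuousAt.2 fun s => ?_
    obtain ⟨y, hy⟩ := hcauchy x s
    rw [← hdi.nhds_eq_comap] at hy
    rwa [← tendsto_nhds_unique (tendsto_pure_nhds _ s) (hy.mono_left (pure_le_nhds s))] at hy
  have hES (x : X) (s : S) : E x s = T s x := hdi.extend_eq (hTcont x) s
  have hrange : DenseRange fun s : S => (s : ℝ≥0) := hdi.dense
  have hElim (x : X) (t : ℝ≥0) :
      Tendsto (fun s => T s x) (comap (fun s : S => (s : ℝ≥0)) (𝓝 t)) (𝓝 (E x t)) :=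
    (((hEcont x).tendsto t).comp tendsto_comap).congr fun s => hES x s
  have hEadd (x y : X) : E (x + y) = fun t => E x t + E y t :=
    hrange.equalizer (hEcont _) ((hEcont x).add (hEcont y))
      (funext fun s => by simp only [Function.comp_apply, hES, map_add])
  have hEsmul (c : ℂ) (x : X) : E (c • x) = fun t => c • E x t :=
    hrange.equalizer (hEcont _) ((hEcont x).const_smul c)
      (funext fun s => by simp only [Function.comp_apply, hES, map_smul])
  choose K hK using fun t : ℝ≥0 => hbound (t + 1)
  have hEbound (x : X) (t : ℝ≥0) : ‖E x t‖ ≤ K t * ‖x‖ := by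
    have : (comap (fun s : S => (s : ℝ≥0)) (𝓝 t)).NeBot := hdi.comap_nhds_neBot t
    refine le_of_tendsto (hElim x t).norm ?_
    have h : ∀ᶠ s in 𝓝 t, s ≤ t + 1 := Iic_mem_nhds (lt_add_one t)
    filter_upwards [tendsto_comap.eventually h] with s hs
    exact (T s).le_of_opNorm_le (hK t s hs) x
  let U : ℝ≥0 → X →L[ℂ] X := fun t => LinearMap.mkContinuous
    { toFun := fun x => E x t
      map_add' := fun x y => congrFun (hEadd x y) t
      map_smul' := fun c x => congrFun (hEsmul c x) t } (K t) fun x => hEbound x t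
  have hUS (s : S) : U s = T s := ContinuousLinearMap.ext fun x => hES x s
  have hUcont (x : X) : Continuous fun t => U t x := hEcont x
  refine ⟨U, ?_, ?_, hUcont, hUS⟩
  · ext x
    have : (comap (fun s : S => (s : ℝ≥0)) (𝓝 0)).NeBot := hdi.comap_nhds_neBot 0
    exact tendsto_nhds_unique (hElim x 0) (hlim x)
  · -- extend the semigroup law from `S × S` to `S × ℝ≥0` and then to `ℝ≥0 × ℝ≥0`
    have h1 (s : S) (x : X) : (fun t => U (s + t) x) = fun t => U s (U t x) :=
      hrange.equalizer ((hUcont x).comp (continuous_const.add continuous_id))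
        ((U s).continuous.comp (hUcont x)) (funext fun t => by
          have := hUS (s + t)
          simp only [Function.comp_apply]
          rw [hUS s, hUS t, ← ContinuousLinearMap.comp_apply, ← hadd, ← this]
          rfl)
    intro s t
    ext x
    exact congrFun (hrange.equalizer ((hUcont x).comp (continuous_id.add continuous_const))
      (hUcont (U t x)) (funext fun s => congrFun (h1 s x) t)) s

end Extension

/-! ### Duality between maps of the algebra and operators on its predual -/

section Duality

variable {H : Type*} [NormedAddCommGroup H] [InnerProductSpace ℂ H] [CompleteSpace H]
variable {M : VonNeumannAlgebra H}

variable (M) in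
/-- The predual as a Banach space. The type synonym keeps the topology reducibly the one induced by
the norm, rather than the subspace topology of `predual M`. -/
def PredualSpace : Type _ := predual M

noncomputable instance : NormedAddCommGroup (PredualSpace M) :=
  inferInstanceAs (NormedAddCommGroup (predual M))

noncomputable instance : NormedSpace ℂ (PredualSpace M) :=
  inferInstanceAs (NormedSpace ℂ (predual M))

instance : CompleteSpace (PredualSpace M) := isClosed_predual.completeSpace_coe

namespace PredualSpace

variable (M) in
/-- The inclusion of the predual into the dual of `M`. -/
noncomputable def incl : PredualSpace M →ₗᵢ[ℂ] StrongDual ℂ M.toStarSubalgebra :=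
  (predual M).subtypeₗᵢ

theorem incl_mem (ρ : PredualSpace M) : incl M ρ ∈ predual M := ρ.2

/-- An element of the predual, as a point of the Banach space `PredualSpace M`. -/
def mk (ρ : StrongDual ℂ M.toStarSubalgebra) (hρ : ρ ∈ predual M) : PredualSpace M := ⟨ρ, hρ⟩

@[simp]
theorem incl_mk (ρ : StrongDual ℂ M.toStarSubalgebra) (hρ : ρ ∈ predual M) :
    incl M (mk ρ hρ) = ρ := rfl

end PredualSpace

open PredualSpace

/-- The restriction to the predual of the Banach space adjoint of a normal bounded map. -/
noncomputable def preadjoint (Φ : M.toStarSubalgebra →L[ℂ] M.toStarSubalgebra)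
    (hΦ : ∀ ρ ∈ predual M, ρ.comp Φ ∈ predual M) : PredualSpace M →L[ℂ] PredualSpace M :=
  LinearMap.mkContinuous
    { toFun := fun ρ : PredualSpace M => mk ((incl M ρ).comp Φ) (hΦ _ ρ.incl_mem)
      map_add' := fun _ _ => rfl
      map_smul' := fun _ _ => rfl } ‖Φ‖ fun ρ => by
    rw [mul_comm]
    exact ContinuousLinearMap.opNorm_comp_le (incl M ρ) Φ

theorem norm_preadjoint_le {Φ : M.toStarSubalgebra →L[ℂ] M.toStarSubalgebra}
    (hΦ : ∀ ρ ∈ predual M, ρ.comp Φ ∈ predual M) : ‖preadjoint Φ hΦ‖ ≤ ‖Φ‖ :=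
  LinearMap.mkContinuous_norm_le _ (norm_nonneg _) _

/-- Every bounded functional on the predual is the evaluation at an element of `M`. -/
theorem exists_forall_incl_apply_eq (F : StrongDual ℂ (PredualSpace M)) :
    ∃ a : M.toStarSubalgebra, ∀ ρ : PredualSpace M, incl M ρ a = F ρ := by
  obtain ⟨G, hG, -⟩ := exists_extension_norm_eq (predual M) F
  obtain ⟨a, ha⟩ := exists_forall_predual_eq G
  exact ⟨a, fun ρ => by rw [← ha _ ρ.incl_mem]; exact hG ρ⟩

/-- Every bounded operator on the predual is the preadjoint of a linear map of `M`. -/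
theorem exists_adjoint (T : PredualSpace M →L[ℂ] PredualSpace M) :
    ∃ ψ : M.toStarSubalgebra →ₗ[ℂ] M.toStarSubalgebra,
      ∀ (ρ : PredualSpace M) (a : M.toStarSubalgebra), incl M ρ (ψ a) = incl M (T ρ) a := by
  choose ψ hψ using fun a : M.toStarSubalgebra => exists_forall_incl_apply_eq
    (ContinuousLinearMap.apply ℂ ℂ a ∘L (incl M).toContinuousLinearMap ∘L T)
  replace hψ (ρ : PredualSpace M) (a : M.toStarSubalgebra) :
    incl M ρ (ψ a) = incl M (T ρ) a := hψ a ρ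
  refine ⟨{ toFun := ψ, map_add' := fun a b => ?_, map_smul' := fun c a => ?_ }, hψ⟩
  · refine eq_of_predual_eq fun ρ hρ => ?_
    rw [← incl_mk ρ hρ, map_add, hψ, hψ, hψ, map_add]
  · refine eq_of_predual_eq fun ρ hρ => ?_
    rw [← incl_mk ρ hρ, RingHom.id_apply, map_smul, hψ, hψ, map_smul]

/-- A bounded map of `M` is normal as soon as it pulls vector states back to the predual. -/
theorem comp_mem_predual {Φ : M.toStarSubalgebra →L[ℂ] M.toStarSubalgebra}
    (hΦ : ∀ h, (vectorFunctional M h h).comp Φ ∈ predual M) {ρ : StrongDual ℂ M.toStarSubalgebra}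
    (hρ : ρ ∈ predual M) : ρ.comp Φ ∈ predual M := by
  let L := (ContinuousLinearMap.compL ℂ M.toStarSubalgebra M.toStarSubalgebra ℂ).flip Φ
  exact predual_le_of_isClosed ((predual M).comap
    (L : StrongDual ℂ M.toStarSubalgebra →ₗ[ℂ] StrongDual ℂ M.toStarSubalgebra))
    (isClosed_predual.preimage L.continuous) hΦ hρ

/-- Right multiplication is normal. -/
theorem comp_mulRight_mem_predual {ρ : StrongDual ℂ M.toStarSubalgebra} (hρ : ρ ∈ predual M)
    (y : M.toStarSubalgebra) :
    ρ.comp ((ContinuousLinearMap.mul ℂ M.toStarSubalgebra).flip y) ∈ predual M :=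
  comp_mem_predual (fun h => vectorFunctional_mem_predual ((y : H →L[ℂ] H) h) h) hρ

/-- Left multiplication is normal. -/
theorem comp_mulLeft_mem_predual {ρ : StrongDual ℂ M.toStarSubalgebra} (hρ : ρ ∈ predual M)
    (x : M.toStarSubalgebra) :
    ρ.comp (ContinuousLinearMap.mul ℂ M.toStarSubalgebra x) ∈ predual M := by
  refine comp_mem_predual (fun h => ?_) hρ
  convert vectorFunctional_mem_predual (M := M) h
    (ContinuousLinearMap.adjoint (x : H →L[ℂ] H) h) using 1
  ext y
  rw [vectorFunctional_apply, ContinuousLinearMap.adjoint_inner_left]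
  rfl

/-- Norm convergence `ρ ∘ Φ i → ρ` for vector states `ρ` passes to the whole predual when the maps
`Φ i` are eventually bounded. -/
theorem tendsto_comp_of_vectorFunctional {ι : Type*} {l : Filter ι}
    {Φ : ι → M.toStarSubalgebra →L[ℂ] M.toStarSubalgebra} {C : ℝ} (hC : ∀ᶠ i in l, ‖Φ i‖ ≤ C)
    (hv : ∀ h, Tendsto (fun i => (vectorFunctional M h h).comp (Φ i)) l
      (𝓝 (vectorFunctional M h h))) {ρ : StrongDual ℂ M.toStarSubalgebra} (hρ : ρ ∈ predual M) :
    Tendsto (fun i => ρ.comp (Φ i)) l (𝓝 ρ) := by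
  let Y : Submodule ℂ (StrongDual ℂ M.toStarSubalgebra) :=
    { carrier := {ρ | Tendsto (fun i => ρ.comp (Φ i)) l (𝓝 ρ)}
      zero_mem' := by
        simpa only [Set.mem_ofPred_eq, ContinuousLinearMap.zero_comp] using tendsto_const_nhds
      add_mem' := fun {ρ σ} hρ hσ => by
        simpa only [Set.mem_ofPred_eq, ContinuousLinearMap.add_comp] using
          Tendsto.add (f := fun i => ρ.comp (Φ i)) hρ hσ
      smul_mem' := fun c ρ hρ => by
        simpa only [Set.mem_ofPred_eq, ContinuousLinearMap.smul_comp] using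
          Tendsto.const_smul (f := fun i => ρ.comp (Φ i)) hρ c }
  refine predual_le_of_isClosed Y (isClosed_of_closure_subset fun τ hτ => ?_) hv hρ
  refine Metric.tendsto_nhds.2 fun ε hε => ?_
  have hC1 : 0 < |C| + 1 := by positivity
  obtain ⟨σ, hσ, hd⟩ := Metric.mem_closure_iff.1 hτ (ε / 2 / (|C| + 1)) (by positivity)
  rw [dist_eq_norm] at hd
  filter_upwards [hC, Metric.tendsto_nhds.1 (show Tendsto (fun i => σ.comp (Φ i)) l (𝓝 σ) from hσ)
    (ε / 2) (by positivity)] with i hi hiσ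
  rw [dist_eq_norm] at hiσ ⊢
  have h1 : ‖(τ - σ).comp (Φ i)‖ ≤ ‖τ - σ‖ * |C| :=
    (ContinuousLinearMap.opNorm_comp_le _ _).trans (by gcongr; exact hi.trans (le_abs_self C))
  have h2 : τ.comp (Φ i) - τ = (τ - σ).comp (Φ i) + (σ.comp (Φ i) - σ) - (τ - σ) := by
    rw [ContinuousLinearMap.sub_comp]; abel
  have h3 := (lt_div_iff₀ hC1).1 hd
  rw [h2]
  have h4 := norm_sub_le ((τ - σ).comp (Φ i) + (σ.comp (Φ i) - σ)) (τ - σ)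
  have h5 := norm_add_le ((τ - σ).comp (Φ i)) (σ.comp (Φ i) - σ)
  linarith

/-- The pairing between a norm continuous family in the predual and a bounded weak* continuous
family in `M` is continuous. -/
theorem continuous_apply_of_forall_predual {Y : Type*} [TopologicalSpace Y]
    {σ : Y → StrongDual ℂ M.toStarSubalgebra} (hσ : Continuous σ) (hσp : ∀ s, σ s ∈ predual M)
    {b : Y → M.toStarSubalgebra} (hb : ∀ ρ ∈ predual M, Continuous fun s => ρ (b s)) {C : ℝ}
    (hC : ∀ s, ‖b s‖ ≤ C) : Continuous fun s => σ s (b s) := by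
  refine continuous_iff_continuousAt.2 fun s₀ => ?_
  have h1 : Tendsto (fun s => (σ s - σ s₀) (b s)) (𝓝 s₀) (𝓝 0) := by
    have h0 : Tendsto (fun s => ‖σ s - σ s₀‖ * C) (𝓝 s₀) (𝓝 0) := by
      simpa using (tendsto_iff_norm_sub_tendsto_zero.1 (hσ.tendsto s₀)).mul_const C
    refine squeeze_zero_norm (fun s => ?_) h0
    exact ((σ s - σ s₀).le_opNorm _).trans (by gcongr; exact hC s)
  have h2 := h1.add ((hb _ (hσp s₀)).tendsto s₀)
  rw [zero_add] at h2
  refine h2.congr fun s => ?_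
  rw [sub_apply, sub_add_cancel]

theorem norm_le_of_forall_norm_vectorFunctional_le {a : M.toStarSubalgebra} {c : ℝ} (hc : 0 ≤ c)
    (ha : ∀ h g, ‖vectorFunctional M h g a‖ ≤ c * (‖h‖ * ‖g‖)) : ‖a‖ ≤ c := by
  refine ContinuousLinearMap.opNorm_le_bound _ hc fun h => ?_
  have := ha h ((a : H →L[ℂ] H) h)
  rw [vectorFunctional_apply, inner_self_eq_norm_sq_to_K, norm_pow, RCLike.norm_ofReal, abs_norm,
    ← mul_assoc, pow_two] at this
  change ‖(a : H →L[ℂ] H) h‖ ≤ _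
  rcases (norm_nonneg ((a : H →L[ℂ] H) h)).eq_or_lt with h0 | h0
  · rw [← h0]; positivity
  · exact le_of_mul_le_mul_right this h0

theorem isPositive_of_forall_vectorFunctional_nonneg {a : M.toStarSubalgebra}
    (ha : ∀ h, 0 ≤ vectorFunctional M h h a) : (a : H →L[ℂ] H).IsPositive := by
  refine (ContinuousLinearMap.isPositive_iff_complex _).2 fun h => ?_
  have h1 := Complex.nonneg_iff.1 (ha h)
  rw [vectorFunctional_apply, ← inner_conj_symm, Complex.conj_re, Complex.conj_im] at h1
  have h2 : (inner ℂ ((a : H →L[ℂ] H) h) h).im = 0 := by simpa using h1.2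
  exact ⟨Complex.ext rfl h2.symm, h1.1⟩

/-- A *-endomorphism maps `1` to a projection. -/
theorem IsStarEndomorphism.norm_one_le {φ : M.toStarSubalgebra →ₗ[ℂ] M.toStarSubalgebra}
    (hφ : IsStarEndomorphism M φ) : ‖φ 1‖ ≤ 1 := by
  refine IsStarProjection.norm_le _ ⟨?_, ?_⟩
  · rw [IsIdempotentElem, ← hφ.1, one_mul]
  · rw [isSelfAdjoint_iff, ← hφ.2, star_one]

/-- The extended semigroup `ψ` exists, together with the strongly continuous semigroup `U` on the
predual of which it is the adjoint. The preadjoints of `φ` are bounded near `0` and strongly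
continuous at `0`, so they extend over `ℝ≥0`, and the extension is dualized. -/
theorem exists_dual_extension (hM : IsDirectSumOfTypeIFactors M)
    {S : AddSubsemigroup ℝ≥0} (hS : Dense (S : Set ℝ≥0))
    (hSsub : ∀ s ∈ S, ∀ t ∈ S, s < t → t - s ∈ S)
    {φ : S → (M.toStarSubalgebra →ₗ[ℂ] M.toStarSubalgebra)}
    (hadd : ∀ s t, φ (s + t) = φ s ∘ₗ φ t)
    (hnormal : ∀ s, IsNormalMap M (φ s)) (hpos : ∀ s, IsPositiveMap M (φ s))
    (hcompact : ∀ x ∈ compactElements M,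
      ∀ ρ : M.toStarSubalgebra →ₗ[ℂ] ℂ, MemPredual M ρ →
        Tendsto (fun s : S => ρ (φ s x)) (comap (fun s : S => (s : ℝ≥0)) (𝓝 0)) (𝓝 (ρ x)))
    (hone : ∀ ρ : M.toStarSubalgebra →ₗ[ℂ] ℂ, MemPredual M ρ →
      Tendsto (fun s : S => ρ (φ s 1)) (comap (fun s : S => (s : ℝ≥0)) (𝓝 0)) (𝓝 (ρ 1))) :
    ∃ (U : ℝ≥0 → PredualSpace M →L[ℂ] PredualSpace M)
      (ψ : ℝ≥0 → (M.toStarSubalgebra →ₗ[ℂ] M.toStarSubalgebra)),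
      (∀ t (ρ : PredualSpace M) a, incl M ρ (ψ t a) = incl M (U t ρ) a) ∧
      (∀ ρ, Continuous fun t => U t ρ) ∧ ψ 0 = LinearMap.id ∧
      (∀ s t, ψ (s + t) = ψ s ∘ₗ ψ t) ∧ ∀ s : S, ψ s = φ s := by
  let Φ : S → M.toStarSubalgebra →L[ℂ] M.toStarSubalgebra := fun s =>
    (φ s).mkContinuous (2 * ‖φ s 1‖) (hpos s).norm_apply_le
  have hΦ (s : S) : ∀ ρ ∈ predual M, ρ.comp (Φ s) ∈ predual M := fun ρ hρ => hnormal s ρ hρ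
  let T : S → PredualSpace M →L[ℂ] PredualSpace M := fun s => preadjoint (Φ s) (hΦ s)
  have hTadd (s t : S) : T (s + t) = T s ∘L T t := by
    refine ContinuousLinearMap.ext fun ρ => (incl M).injective (ContinuousLinearMap.ext fun a => ?_)
    change incl M ρ (φ (s + t) a) = incl M ρ (φ t (φ s a))
    rw [add_comm, hadd]
    rfl
  obtain ⟨C, hC⟩ : ∃ C, ∀ᶠ s in comap (fun s : S => (s : ℝ≥0)) (𝓝 0),
      ‖((φ s 1 : M.toStarSubalgebra) : H →L[ℂ] H)‖ ≤ C :=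
    exists_eventually_norm_le (B := 1) fun h g =>
      hone (vectorFunctional M h g : M.toStarSubalgebra →ₗ[ℂ] ℂ) (vectorFunctional_mem_predual h g)
  have hCΦ : ∀ᶠ s in comap (fun s : S => (s : ℝ≥0)) (𝓝 0), ‖Φ s‖ ≤ 2 * C := by
    filter_upwards [hC] with s hs
    have hs' : ‖φ s 1‖ ≤ C := hs
    exact (LinearMap.mkContinuous_norm_le _ (by positivity) _).trans (by gcongr)
  have hlimv (h : H) : Tendsto (fun s => (vectorFunctional M h h).comp (Φ s))
      (comap (fun s : S => (s : ℝ≥0)) (𝓝 0)) (𝓝 (vectorFunctional M h h)) :=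
    tendsto_vectorFunctional_of_compact hM h
      (fun s => (hpos s).isPositiveFunctional_comp (isPositiveFunctional_vectorFunctional h))
      (fun x hx => hcompact x hx _ (vectorFunctional_mem_predual h h))
      (hone _ (vectorFunctional_mem_predual h h))
  obtain ⟨U, hU0, hUadd, hUcont, hUS⟩ := exists_strongly_continuous_extension hS hSsub hTadd
    (hCΦ.mono fun s hs => (norm_preadjoint_le (hΦ s)).trans hs)
    (fun ρ => (incl M).isometry.isEmbedding.tendsto_nhds_iff.2
      (tendsto_comp_of_vectorFunctional hCΦ hlimv ρ.incl_mem))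
  choose ψ hψ using fun t => exists_adjoint (U t)
  refine ⟨U, ψ, hψ, hUcont, ?_, fun s t => ?_, fun s => ?_⟩
  · refine LinearMap.ext fun a => eq_of_predual_eq fun ρ hρ => ?_
    rw [← incl_mk ρ hρ, hψ, hU0]
    rfl
  · refine LinearMap.ext fun a => eq_of_predual_eq fun ρ hρ => ?_
    rw [← incl_mk ρ hρ, hψ, add_comm, hUadd, LinearMap.comp_apply, hψ s, hψ t]
    rfl
  · refine LinearMap.ext fun a => eq_of_predual_eq fun ρ hρ => ?_
    rw [← incl_mk ρ hρ, hψ, hUS]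
    rfl

theorem continuous_apply_dual {U : ℝ≥0 → PredualSpace M →L[ℂ] PredualSpace M}
    {ψ : ℝ≥0 → (M.toStarSubalgebra →ₗ[ℂ] M.toStarSubalgebra)}
    (hψ : ∀ t (ρ : PredualSpace M) a, incl M ρ (ψ t a) = incl M (U t ρ) a)
    (hU : ∀ ρ, Continuous fun t => U t ρ) {ρ : StrongDual ℂ M.toStarSubalgebra}
    (hρ : ρ ∈ predual M) (a : M.toStarSubalgebra) : Continuous fun t => ρ (ψ t a) := by
  have : Continuous fun t => incl M (U t (mk ρ hρ)) a :=
    (ContinuousLinearMap.apply ℂ ℂ a).continuous.comp ((incl M).continuous.comp (hU (mk ρ hρ)))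
  exact this.congr fun t => (hψ t (mk ρ hρ) a).symm

/-- Multiplicativity passes to the extension: for `s` in `S` with `s < t` the identity
`ψ s (ψ (t - s) x * y) = ψ t x * ψ s y` holds, and it is continued to `s = t`, where norm continuity
of the preadjoint orbits makes up for the joint discontinuity of the weak* pairing. -/
theorem map_mul_of_dense {S : AddSubsemigroup ℝ≥0} (hS : Dense (S : Set ℝ≥0))
    {U : ℝ≥0 → PredualSpace M →L[ℂ] PredualSpace M}
    {ψ : ℝ≥0 → (M.toStarSubalgebra →ₗ[ℂ] M.toStarSubalgebra)}
    (hψ : ∀ t (ρ : PredualSpace M) a, incl M ρ (ψ t a) = incl M (U t ρ) a)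
    (hU : ∀ ρ, Continuous fun t => U t ρ) (h0 : ψ 0 = LinearMap.id)
    (hadd : ∀ s t, ψ (s + t) = ψ s ∘ₗ ψ t)
    (hmul : ∀ s ∈ S, ∀ x y, ψ s (x * y) = ψ s x * ψ s y) {x : M.toStarSubalgebra} {C : ℝ}
    (hC : ∀ t, ‖ψ t x‖ ≤ C) (t : ℝ≥0) (y : M.toStarSubalgebra) :
    ψ t (x * y) = ψ t x * ψ t y := by
  rcases eq_or_ne t 0 with rfl | ht
  · rw [h0]; rfl
  refine eq_of_predual_eq fun ρ hρ => ?_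
  let f : ℝ≥0 → ℂ := fun s => incl M (U s (mk ρ hρ)) (ψ (t - s) x * y)
  let g : ℝ≥0 → ℂ := fun s => ρ (ψ t x * ψ s y)
  have hf : Continuous f := by
    refine continuous_apply_of_forall_predual (C := C * ‖y‖) ((incl M).continuous.comp (hU _))
      (fun s => (U s _).incl_mem) (fun σ hσ => ?_) fun s => ?_
    · exact (continuous_apply_dual hψ hU (comp_mulRight_mem_predual hσ y) x).comp
        (continuous_const.sub continuous_id)
    · exact (norm_mul_le _ _).trans (by gcongr; exact hC _)
  have hg : Continuous g := continuous_apply_dual hψ hU (comp_mulLeft_mem_predual hρ (ψ t x)) y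
  have heq : Set.EqOn f g (Set.Iio t ∩ S) := by
    rintro s ⟨hst, hs⟩
    have h1 : ψ s (ψ (t - s) x * y) = ψ t x * ψ s y := by
      rw [hmul s hs, ← LinearMap.comp_apply, ← hadd, add_tsub_cancel_of_le (le_of_lt hst)]
    calc f s = ρ (ψ s (ψ (t - s) x * y)) := (hψ s (mk ρ hρ) _).symm
      _ = g s := by rw [h1]
  have hmem : t ∈ closure (Set.Iio t ∩ (S : Set ℝ≥0)) := by
    have h3 := closure_mono (hS.open_subset_closure_inter (isOpen_Iio (a := t)))
    rw [closure_closure, closure_Iio' ⟨0, pos_iff_ne_zero.2 ht⟩] at h3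
    exact h3 (Set.mem_Iic.2 le_rfl)
  calc ρ (ψ t (x * y)) = f t := by
        simp only [f]
        rw [tsub_self, h0, LinearMap.id_apply]
        exact hψ t (mk ρ hρ) _
    _ = g t := heq.closure hf hg hmem

end Duality

end VNSemigroup

open VNSemigroup PredualSpace in
theorem theorem5p2 {H : Type*} [NormedAddCommGroup H] [InnerProductSpace ℂ H] [CompleteSpace H]
    (M : VonNeumannAlgebra H) (hM : VNSemigroup.IsDirectSumOfTypeIFactors M)
    (S : AddSubsemigroup ℝ≥0) (hS : Dense (S : Set ℝ≥0))
    (hSsub : ∀ s ∈ S, ∀ t ∈ S, s < t → t - s ∈ S)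
    (φ : S → (M.toStarSubalgebra →ₗ[ℂ] M.toStarSubalgebra))
    (hφ : VNSemigroup.IsSemigroupOver M S φ)
    (hnormal : ∀ s, VNSemigroup.IsNormalMap M (φ s))
    (hpos : ∀ s, VNSemigroup.IsPositiveMap M (φ s))
    (hcompact : ∀ x ∈ VNSemigroup.compactElements M,
      ∀ ρ : M.toStarSubalgebra →ₗ[ℂ] ℂ, VNSemigroup.MemPredual M ρ →
        Tendsto (fun s : S => ρ (φ s x)) (comap (fun s : S => (s : ℝ≥0)) (𝓝 0)) (𝓝 (ρ x)))
    (hone : ∀ ρ : M.toStarSubalgebra →ₗ[ℂ] ℂ, VNSemigroup.MemPredual M ρ →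
      Tendsto (fun s : S => ρ (φ s 1)) (comap (fun s : S => (s : ℝ≥0)) (𝓝 0)) (𝓝 (ρ 1))) :
    ∃ ψ : ℝ≥0 → (M.toStarSubalgebra →ₗ[ℂ] M.toStarSubalgebra),
      ψ 0 = LinearMap.id ∧
      (∀ s t : ℝ≥0, ψ (s + t) = ψ s ∘ₗ ψ t) ∧
      (∀ t, VNSemigroup.IsNormalMap M (ψ t)) ∧
      (∀ t, VNSemigroup.IsPositiveMap M (ψ t)) ∧
      (∀ s : S, ψ s = φ s) ∧
      (∀ (a : M.toStarSubalgebra) (ρ : M.toStarSubalgebra →ₗ[ℂ] ℂ), VNSemigroup.MemPredual M ρ →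
        ∀ t₀ : ℝ≥0, Tendsto (fun t : ℝ≥0 => ρ (ψ t a)) (𝓝 t₀) (𝓝 (ρ (ψ t₀ a)))) ∧
      ((∀ s, VNSemigroup.IsContractive M (φ s)) → ∀ t, VNSemigroup.IsContractive M (ψ t)) ∧
      ((∀ s, VNSemigroup.IsCompletelyPositive M (φ s)) →
        ∀ t, VNSemigroup.IsCompletelyPositive M (ψ t)) ∧
      ((∀ s, φ s 1 = 1) → ∀ t, ψ t 1 = 1) ∧
      ((∀ s, VNSemigroup.IsStarEndomorphism M (φ s)) →
        ∀ t, VNSemigroup.IsStarEndomorphism M (ψ t)) := by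
  obtain ⟨U, ψ, hψ, hU, h0, hadd, hS'⟩ := exists_dual_extension hM hS hSsub hφ.map_add hnormal hpos
    hcompact hone
  have hcont (ρ : M.toStarSubalgebra →ₗ[ℂ] ℂ) (hρ : MemPredual M ρ) (a : M.toStarSubalgebra) :
      Continuous fun t => ρ (ψ t a) := by
    obtain ⟨σ, hσ, rfl⟩ := hρ.exists_strongDual
    exact continuous_apply_dual hψ hU hσ a
  have hvcont (h g : H) (a : M.toStarSubalgebra) :
      Continuous fun t => vectorFunctional M h g (ψ t a) :=
    hcont _ (vectorFunctional_mem_predual h g) a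
  have hrange : DenseRange fun s : S => (s : ℝ≥0) := hS.denseRange_val
  have hnorm {a : M.toStarSubalgebra} {c : ℝ} (hc : 0 ≤ c) (ha : ∀ s, ‖φ s a‖ ≤ c) (t : ℝ≥0) :
      ‖ψ t a‖ ≤ c := by
    refine norm_le_of_forall_norm_vectorFunctional_le hc fun h g => ?_
    refine hrange.induction_on (p := fun t => ‖vectorFunctional M h g (ψ t a)‖ ≤ c * (‖h‖ * ‖g‖)) t
      (isClosed_le (hvcont h g a).norm continuous_const) fun s => ?_
    rw [hS', mul_comm c]
    exact (ContinuousLinearMap.le_opNorm _ _).trans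
      (mul_le_mul (norm_vectorFunctional_le M h g) (ha s) (norm_nonneg _) (by positivity))
  refine ⟨ψ, h0, hadd, fun t ρ hρ => ?_, fun t a ha => ?_, hS',
    fun a ρ hρ t₀ => (hcont ρ hρ a).tendsto t₀, fun hcontr t a => hnorm (norm_nonneg a)
      (fun s => hcontr s a) t, fun hcp t n a ha h => ?_, fun hunit t => ?_, fun hend t => ?_⟩
  · obtain ⟨σ, hσ, rfl⟩ := hρ.exists_strongDual
    have : (σ : M.toStarSubalgebra →ₗ[ℂ] ℂ) ∘ₗ ψ t =
        (incl M (U t (mk σ hσ)) : M.toStarSubalgebra →ₗ[ℂ] ℂ) :=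
      LinearMap.ext fun a => hψ t (mk σ hσ) a
    rw [this]
    exact (U t (mk σ hσ)).incl_mem
  · refine isPositive_of_forall_vectorFunctional_nonneg fun h => ?_
    refine hrange.induction_on (p := fun t => 0 ≤ vectorFunctional M h h (ψ t a)) t
      (isClosed_le continuous_const (hvcont h h a)) fun s => ?_
    rw [hS']
    exact isPositiveFunctional_vectorFunctional h _ (hpos s a ha)
  · refine hrange.induction_on
      (p := fun t => 0 ≤ ∑ i, ∑ j, vectorFunctional M (h j) (h i) (ψ t (a i j))) t
      (isClosed_le continuous_const (continuous_finsetSum _ fun i _ =>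
        continuous_finsetSum _ fun j _ => hvcont _ _ _)) fun s => ?_
    rw [hS']
    exact hcp s n a ha h
  · refine eq_of_predual_eq fun ρ hρ => ?_
    refine hrange.induction_on (p := fun t => ρ (ψ t 1) = ρ 1) t
      (isClosed_eq (hcont ρ hρ 1) continuous_const) fun s => ?_
    rw [hS', hunit]
  · refine ⟨fun x y => ?_, fun x => ?_⟩
    · refine map_mul_of_dense hS hψ hU h0 hadd (fun s hs x y => ?_) (C := 2 * ‖x‖)
        (hnorm (by positivity) fun s => ?_) t y
      · rw [hS' ⟨s, hs⟩]
        exact (hend ⟨s, hs⟩).1 x y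
      · refine ((hpos s).norm_apply_le x).trans ?_
        have := (hend s).norm_one_le
        gcongr
        linarith
    · refine Subtype.ext (ContinuousLinearMap.ext fun h => ext_inner_left ℂ fun g => ?_)
      have hstar (b : M.toStarSubalgebra) :
          vectorFunctional M h g (star b) = (starRingEnd ℂ) (vectorFunctional M g h b) := by
        rw [vectorFunctional_apply, vectorFunctional_apply, inner_conj_symm]
        exact ContinuousLinearMap.adjoint_inner_right _ _ _
      change vectorFunctional M h g (ψ t (star x)) = vectorFunctional M h g (star (ψ t x))
      rw [hstar]
      refine hrange.induction_on (p := fun t => vectorFunctional M h g (ψ t (star x)) =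
        (starRingEnd ℂ) (vectorFunctional M g h (ψ t x))) t
        (isClosed_eq (hvcont h g _) (Complex.continuous_conj.comp (hvcont g h x))) fun s => ?_
      rw [hS', (hend s).2, hstar]
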